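/- Let $(x)_n := x(x+1)\cdots(x+n-1)$ for $n\ge 1$ and $(x)_0:=1$. The four functions, given by their power series at the origin, $$ f(z)=\sum_{n=0}^\infty\frac{(4n)!}{(2n)!\,n!^2}z^n,\qquad g(z)=\sum_{n=0}^\infty\left(\sum_{k=0}^n\binom{n}{k}^2\binom{n+k}{k}^2\right)z^n, $$ $$ h(z)=\sum_{n=0}^\infty\frac{(1/6)_n(1/2)_n}{(2/3)_n\,n!}z^n,\qquad i(z)=\sum_{n=0}^\infty\frac{(1/5)_n^3}{(2/7)_n\,n!^2}z^n $$ are algebraically independent over the field $\mathbb{C}(z)$ of rational functions; that is, there is no nonzero polynomial $P\in\mathbb{C}(z)[Y_1,Y_2,Y_3,Y_4]$ with $P(f(z),g(z),h(z),i(z))=0$. -/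

import Mathlib

open scoped Nat RatFunc

namespace MixedExample

noncomputable section

/-- `∑ (4n)! / ((2n)! n!²) zⁿ`. -/
def f : PowerSeries ℂ :=
  PowerSeries.mk fun n => ((4 * n)! : ℂ) / (((2 * n)! : ℂ) * (n ! : ℂ) ^ 2)

/-- The generating series of the Apéry numbers `∑ₖ C(n,k)² C(n+k,k)²`. -/
def g : PowerSeries ℂ :=
  PowerSeries.mk fun n =>
    ((∑ k ∈ Finset.range (n + 1), n.choose k ^ 2 * (n + k).choose k ^ 2 : ℕ) : ℂ)

/-- The Pochhammer symbol `(x)ₙ = x (x + 1) ⋯ (x + n - 1)`, with `(x)₀ = 1`. -/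
def poch (x : ℂ) (n : ℕ) : ℂ := (ascPochhammer ℂ n).eval x

/-- `∑ (1/6)ₙ (1/2)ₙ / ((2/3)ₙ n!) zⁿ`. -/
def h : PowerSeries ℂ :=
  PowerSeries.mk fun n => poch (1 / 6) n * poch (1 / 2) n / (poch (2 / 3) n * (n ! : ℂ))

/-- `∑ (1/5)ₙ³ / ((2/7)ₙ n!²) zⁿ`. -/
def i : PowerSeries ℂ :=
  PowerSeries.mk fun n => poch (1 / 5) n ^ 3 / (poch (2 / 7) n * (n ! : ℂ) ^ 2)

end

end MixedExample

/-! Arithmetic turns an algebraic relation into a multiplicative one; real analysis then rules the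
latter out.

For a prime `p ≡ 1` mod 420 each coefficient sequence satisfies `a (m p + b) ≡ a m * a b` for `b <
p` (`isLucas_seq`). Hence each reduced series satisfies `w = A * w ^ p` with `A` a polynomial of
degree below `p` (`IsLucas.eq_trunc_mul_pow`). Given a linear relation over `𝔽_p[z]` between
monomials in such series, its Frobenius image is again a relation between the same monomials. For a
shortest relation the two are proportional, so the ratio of two terms is fixed by Frobenius and is a
constant: two distinct monomials differ by a rational function (`exists_ratio_of_relation`). Its
height is bounded independently of `p`, because a `(p - 1)`-st power divides a product of boundedly
many polynomials of degree at most `p - 1`.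

A relation over `ℂ(z)` descends to `ℚ(z)` and reduces modulo all large good primes. By pigeonhole
one pair of monomials serves infinitely many of them. Having a rational ratio of bounded height is a
linear system with a fixed number of unknowns, so solvability modulo infinitely many primes gives
solvability over `ℚ` (`exists_rat_ratio`). The outcome is `exists_multiplicative_relation`.

The exponents on both sides are compared at the dominant singularities `1/64 < 17 - 12√2 < 1` of
`f`, `g` and of the pair `h`, `i` (`exponents_eq`). A series whose scaled coefficients lie between
constants times `1/n²` and `1/n` is, at its singularity, either unbounded with logarithmic growth or
bounded but not Lipschitz. Neither fits a rational function times a `C¹` nonvanishing cofactor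
(`Tame.false_of_contDiffAt`). At `1`, `h` tends to infinity while `i` stays bounded, which separates
them. -/

namespace LucasSeries

open Polynomial (natDegree)

/-! ### Kummer theory for Frobenius equations in characteristic `p`. -/

/-- The monomial `∏ i, w i ^ m i`. -/
noncomputable def monom {ι R : Type*} [Fintype ι] [CommSemiring R] (w : ι → R) (m : ι → ℕ) : R :=
  ∏ i, w i ^ m i

theorem monom_ne_zero {ι R : Type*} [Fintype ι] [CommRing R] [IsDomain R] {w : ι → R}
    (hw : ∀ i, w i ≠ 0) (m : ι → ℕ) : monom w m ≠ 0 :=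
  Finset.prod_ne_zero_iff.2 fun i _ => pow_ne_zero _ (hw i)

theorem map_monom {ι R S : Type*} [Fintype ι] [CommSemiring R] [CommSemiring S] (e : R →+* S)
    (w : ι → R) (m : ι → ℕ) : e (monom w m) = monom (fun i => e (w i)) m := by
  simp [monom, map_prod]

/-- In a domain of characteristic `p`, two elements whose ratio is fixed by Frobenius differ by a
constant of the prime field. -/
theorem exists_zmod_mul_eq {p : ℕ} [Fact p.Prime] {L : Type*} [CommRing L] [IsDomain L]
    [Algebra (ZMod p) L] {x y : L} (hy : y ≠ 0) (hxy : x ^ p * y = y ^ p * x) :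
    ∃ ζ : ZMod p, x = algebraMap (ZMod p) L ζ * y := by
  have : CharP L p := charP_of_injective_algebraMap (algebraMap (ZMod p) L).injective p
  have hpol : (Polynomial.X ^ p - Polynomial.X : Polynomial (ZMod p)) =
      ∏ a : ZMod p, (Polynomial.X - Polynomial.C a) := by
    have h1 := FiniteField.roots_X_pow_card_sub_X (ZMod p)
    rw [ZMod.card] at h1
    have hp := (Fact.out : p.Prime).one_lt
    have hdeg := FiniteField.X_pow_card_sub_X_natDegree_eq (ZMod p) hp
    have hmon : (Polynomial.X ^ p - Polynomial.X : Polynomial (ZMod p)).Monic :=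
      Polynomial.monic_X_pow_sub (by simpa using hp)
    have h2 := Polynomial.prod_multiset_X_sub_C_of_monic_of_roots_card_eq hmon
      (by rw [h1, hdeg]; simp [ZMod.card])
    rw [h1] at h2
    exact h2.symm
  let F := FractionRing L
  set e := algebraMap L F
  have hy' : e y ≠ 0 := by simpa [e] using hy
  have ht : (e x / e y) ^ p - e x / e y = 0 := by
    have h3 : e x ^ p * e y = e y ^ p * e x := by
      simpa using congrArg e hxy
    rw [div_pow, sub_eq_zero, div_eq_div_iff (pow_ne_zero _ hy') hy', h3, mul_comm]
  have h4 := congrArg (Polynomial.eval₂ (e.comp (algebraMap (ZMod p) L)) (e x / e y)) hpol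
  rw [Polynomial.eval₂_sub, Polynomial.eval₂_X_pow, Polynomial.eval₂_X, ht,
    Polynomial.eval₂_finsetProd] at h4
  obtain ⟨ζ, -, hζ⟩ := Finset.prod_eq_zero_iff.1 h4.symm
  refine ⟨ζ, IsFractionRing.injective L F ?_⟩
  rw [Polynomial.eval₂_sub, Polynomial.eval₂_X, Polynomial.eval₂_C, sub_eq_zero,
    div_eq_iff hy'] at hζ
  rw [map_mul]
  exact hζ

section Kummer

variable {p : ℕ} [Fact p.Prime] {ι : Type*} [Fintype ι]

/-- After division by the gcd the two `(p - 1)`-st powers are coprime, so each divides the opposite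
cofactor. -/
theorem exists_isCoprime_of_mul_pow_eq {a b u v : Polynomial (ZMod p)} (ha : a ≠ 0) (hb : b ≠ 0)
    (hab : a ^ (p - 1) * u = b ^ (p - 1) * v) :
    ∃ g a' b', g ≠ 0 ∧ a' ≠ 0 ∧ b' ≠ 0 ∧ a = g * a' ∧ b = g * b' ∧
      a' ^ (p - 1) ∣ v ∧ b' ^ (p - 1) ∣ u := by
  set g := gcd a b
  have hg : g ≠ 0 := fun h => ha ((gcd_eq_zero_iff a b).1 h).1
  have hcop := isCoprime_div_gcd_div_gcd (p := a) hb
  have ea : a = g * (a / g) := (EuclideanDomain.mul_div_cancel' hg (gcd_dvd_left a b)).symm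
  have eb : b = g * (b / g) := (EuclideanDomain.mul_div_cancel' hg (gcd_dvd_right a b)).symm
  have hco : (a / g) ^ (p - 1) * u = (b / g) ^ (p - 1) * v := by
    rw [ea, eb, mul_pow, mul_pow, mul_assoc, mul_assoc] at hab
    exact mul_left_cancel₀ (pow_ne_zero _ hg) hab
  refine ⟨g, a / g, b / g, hg, ?_, ?_, ea, eb, ?_, ?_⟩
  · intro h; rw [h, mul_zero] at ea; exact ha ea
  · intro h; rw [h, mul_zero] at eb; exact hb eb
  · exact (hcop.pow (m := p - 1) (n := p - 1)).dvd_of_dvd_mul_left ⟨u, hco.symm⟩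
  · exact (hcop.pow (m := p - 1) (n := p - 1)).symm.dvd_of_dvd_mul_left ⟨v, hco⟩

/-- The exponent `p - 1` on the left cancels the degree bound `p - 1` on the right. The resulting
bound does not involve `p`, which is what makes the passage to characteristic zero possible. -/
theorem natDegree_le_of_pow_dvd_monom {A : ι → Polynomial (ZMod p)} (hA0 : ∀ i, A i ≠ 0)
    (hA : ∀ i, natDegree (A i) ≤ p - 1) {D : ℕ} {m : ι → ℕ} (hm : ∀ i, m i ≤ D)
    {a : Polynomial (ZMod p)} (ha : a ^ (p - 1) ∣ monom A m) :
    natDegree a ≤ Fintype.card ι * D := by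
  have h1 := Polynomial.natDegree_le_of_dvd ha (monom_ne_zero hA0 m)
  have h2 : natDegree (monom A m) ≤ ∑ _i : ι, D * (p - 1) :=
    (Polynomial.natDegree_prod_le _ _).trans <| Finset.sum_le_sum fun i _ =>
      (Polynomial.natDegree_pow_le_of_le _ (hA i)).trans (Nat.mul_le_mul_right _ (hm i))
  have hp : 0 < p - 1 := Nat.sub_pos_of_lt (Fact.out : p.Prime).one_lt
  rw [Polynomial.natDegree_pow] at h1
  rw [Finset.sum_const, Finset.card_univ, smul_eq_mul] at h2
  refine Nat.le_of_mul_le_mul_left (h1.trans (h2.trans (le_of_eq ?_))) hp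
  ring

/-- A linear relation over `𝔽_p[z]` between monomials in series `w i = A i * w i ^ p` forces the
ratio of two of the monomials to be a rational function of bounded height. -/
theorem exists_ratio_of_relation {w : ι → PowerSeries (ZMod p)} {A : ι → Polynomial (ZMod p)}
    (hw0 : ∀ i, w i ≠ 0) (hA : ∀ i, natDegree (A i) ≤ p - 1)
    (hw : ∀ i, w i = (A i : PowerSeries (ZMod p)) * w i ^ p) {D : ℕ} :
    ∀ (s : Finset (ι → ℕ)) (_ : ∀ m ∈ s, ∀ i, m i ≤ D) (c : (ι → ℕ) → Polynomial (ZMod p))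
      (_ : ∃ m ∈ s, c m ≠ 0)
      (_ : ∑ m ∈ s, (c m : PowerSeries (ZMod p)) * monom w m = 0),
      ∃ m ∈ s, ∃ m' ∈ s, m ≠ m' ∧ ∃ P Q : Polynomial (ZMod p), P ≠ 0 ∧ Q ≠ 0 ∧
        natDegree P ≤ Fintype.card ι * D ∧ natDegree Q ≤ Fintype.card ι * D ∧
        (Q : PowerSeries (ZMod p)) * monom w m = (P : PowerSeries (ZMod p)) * monom w m' := by
  classical
  have hA0 : ∀ i, A i ≠ 0 := fun i h => hw0 i (by rw [hw i, h]; simp)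
  intro s
  induction hn : s.card using Nat.strong_induction_on generalizing s with
  | _ n ih =>
  subst hn
  intro hD c hc hrel
  by_cases hall : ∃ m0 ∈ s, c m0 = 0
  · obtain ⟨m0, hm0, hc0⟩ := hall
    obtain ⟨m1, hm1, hc1⟩ := hc
    have h1 : m1 ∈ s.erase m0 := Finset.mem_erase.2 ⟨fun h => hc1 (h ▸ hc0), hm1⟩
    obtain ⟨m, hm, m', hm', hP⟩ := ih _ (Finset.card_erase_lt_of_mem hm0) (s.erase m0) rfl
      (fun m hm => hD m (Finset.mem_of_mem_erase hm)) c ⟨m1, h1, hc1⟩ (by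
        rw [← hrel, ← Finset.add_sum_erase s _ hm0, hc0]; simp)
    exact ⟨m, Finset.mem_of_mem_erase hm, m', Finset.mem_of_mem_erase hm', hP⟩
  push Not at hall
  obtain ⟨m0, hm0, hc0⟩ := hc
  -- Coefficients of the Frobenius image: the `p`-th power of the relation, multiplied by `∏ A i ^
  -- D` so that `A i * w i ^ p = w i` absorbs all the powers `w i ^ p`.
  let d : (ι → ℕ) → Polynomial (ZMod p) := fun m => c m ^ p * monom A fun i => D - m i
  have hfrob : ∀ m ∈ s, ((monom A fun _ => D : Polynomial (ZMod p)) : PowerSeries (ZMod p)) * monom w m ^ p =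
      (monom A (fun i => D - m i) : Polynomial (ZMod p)) * monom w m := by
    intro m hm
    have e1 := map_monom (Polynomial.coeToPowerSeries.ringHom (R := ZMod p)) A
    simp only [Polynomial.coeToPowerSeries.ringHom_apply] at e1
    rw [e1, e1]
    simp only [monom]
    rw [← Finset.prod_pow, ← Finset.prod_mul_distrib, ← Finset.prod_mul_distrib]
    refine Finset.prod_congr rfl fun i _ => ?_
    conv_rhs => rw [hw i]
    rw [mul_pow, ← mul_assoc, ← pow_add, Nat.sub_add_cancel (hD m hm i), ← pow_mul, ← pow_mul,
      mul_comm p]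
  have hrel2 : ∑ m ∈ s, (d m : PowerSeries (ZMod p)) * monom w m = 0 := by
    have h1 : (∑ m ∈ s, (c m : PowerSeries (ZMod p)) * monom w m) ^ p = 0 := by
      rw [hrel, zero_pow (Fact.out : p.Prime).ne_zero]
    have : CharP (PowerSeries (ZMod p)) p :=
      charP_of_injective_algebraMap (algebraMap (ZMod p) _).injective p
    rw [sum_pow_char] at h1
    have h2 := congrArg (((monom A fun _ => D : Polynomial (ZMod p)) : PowerSeries (ZMod p)) * ·) h1
    simp only [mul_zero, Finset.mul_sum] at h2
    rw [← h2]
    refine Finset.sum_congr rfl fun m hm => ?_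
    rw [mul_pow, mul_left_comm, hfrob m hm, Polynomial.coe_mul, Polynomial.coe_pow, mul_assoc]
  have hw0' : ∀ m, monom w m ≠ 0 := monom_ne_zero hw0
  -- Eliminates `m0` between the two relations. Either a shorter nontrivial relation results, or the
  -- relations are proportional.
  let e : (ι → ℕ) → Polynomial (ZMod p) := fun m => c m0 * d m - d m0 * c m
  have he0 : e m0 = 0 := by simp [e, mul_comm]
  have hrel3 : ∑ m ∈ s, (e m : PowerSeries (ZMod p)) * monom w m = 0 := by
    have h1 : ∀ m ∈ s, (e m : PowerSeries (ZMod p)) * monom w m =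
        (c m0 : PowerSeries (ZMod p)) * (d m * monom w m) -
          (d m0 : PowerSeries (ZMod p)) * (c m * monom w m) := by
      intro m _
      simp only [e, Polynomial.coe_sub, Polynomial.coe_mul]
      ring
    rw [Finset.sum_congr rfl h1, Finset.sum_sub_distrib, ← Finset.mul_sum, ← Finset.mul_sum,
      hrel, hrel2]
    simp
  by_cases hall2 : ∃ m ∈ s.erase m0, e m ≠ 0
  · obtain ⟨m, hm, m', hm', hP⟩ := ih _ (Finset.card_erase_lt_of_mem hm0) (s.erase m0) rfl
      (fun m hm => hD m (Finset.mem_of_mem_erase hm)) e hall2 (by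
        rw [← hrel3, ← Finset.add_sum_erase s _ hm0, he0]; simp)
    exact ⟨m, Finset.mem_of_mem_erase hm, m', Finset.mem_of_mem_erase hm', hP⟩
  push Not at hall2
  obtain ⟨m, hm⟩ : (s.erase m0).Nonempty := by
    rw [Finset.nonempty_iff_ne_empty]
    intro h
    rw [← Finset.add_sum_erase s _ hm0, h, Finset.sum_empty, add_zero] at hrel
    exact (mul_ne_zero (by simpa using hc0) (hw0' m0)) hrel
  have hms := Finset.mem_of_mem_erase hm
  have hem := hall2 m hm
  simp only [e, d, sub_eq_zero] at hem
  have hcm := hall m hms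
  have hp1 : p = p - 1 + 1 := (Nat.sub_add_cancel (Fact.out : p.Prime).one_lt.le).symm
  have hpow : c m ^ (p - 1) * monom A (fun i => D - m i) =
      c m0 ^ (p - 1) * monom A (fun i => D - m0 i) := by
    refine mul_left_cancel₀ (mul_ne_zero hc0 hcm) ?_
    have h1 : ∀ a : Polynomial (ZMod p), a ^ p = a ^ (p - 1) * a := fun a => by
      rw [← pow_succ, ← hp1]
    rw [h1, h1] at hem
    linear_combination hem
  -- Proportionality of the relations says that the ratio of the terms at `m` and `m0` is fixed by
  -- Frobenius.
  have hxy : ((c m : PowerSeries (ZMod p)) * monom w m) ^ p * (c m0 * monom w m0) =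
      ((c m0 : PowerSeries (ZMod p)) * monom w m0) ^ p * (c m * monom w m) := by
    have h0 : ((monom A fun _ => D : Polynomial (ZMod p)) : PowerSeries (ZMod p)) ≠ 0 := by
      simpa using monom_ne_zero hA0 _
    refine mul_left_cancel₀ h0 ?_
    have h1 := hfrob m hms
    have h2 := hfrob m0 hm0
    have h3 : (c m0 : PowerSeries (ZMod p)) *
        ((c m) ^ p * (monom A fun i => D - m i : Polynomial (ZMod p))) =
        c m0 ^ p * (monom A fun i => D - m0 i : Polynomial (ZMod p)) * c m := by
      exact_mod_cast congrArg (fun q : Polynomial (ZMod p) => (q : PowerSeries (ZMod p))) hem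
    rw [mul_pow, mul_pow]
    linear_combination (c m : PowerSeries (ZMod p)) ^ p * c m0 * monom w m0 * h1 -
      (c m0 : PowerSeries (ZMod p)) ^ p * c m * monom w m * h2 + monom w m * monom w m0 * h3
  obtain ⟨ζ, hζ⟩ := exists_zmod_mul_eq
    (mul_ne_zero (by simpa using hc0) (hw0' m0)) hxy
  obtain ⟨g, a', b', hg, ha', hb', ha, hb, hda, hdb⟩ :=
    exists_isCoprime_of_mul_pow_eq hcm hc0 hpow
  have hdeg : ∀ (m : ι → ℕ) (i : ι), D - m i ≤ D := fun m i => Nat.sub_le _ _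
  have hζ0 : ζ ≠ 0 := by
    rintro rfl
    rw [map_zero, zero_mul] at hζ
    exact mul_ne_zero (by simpa using hcm) (hw0' m) hζ
  refine ⟨m, hms, m0, hm0, (Finset.mem_erase.1 hm).1, Polynomial.C ζ * b', a',
    mul_ne_zero (by simpa using hζ0) hb', ha',
    (Polynomial.natDegree_C_mul_le _ _).trans
      (natDegree_le_of_pow_dvd_monom hA0 hA (hdeg m) hdb),
    natDegree_le_of_pow_dvd_monom hA0 hA (hdeg m0) hda, ?_⟩
  have hg' : (g : PowerSeries (ZMod p)) ≠ 0 := by simpa using hg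
  refine mul_left_cancel₀ hg' ?_
  rw [ha, hb, Polynomial.coe_mul, Polynomial.coe_mul, PowerSeries.algebraMap_apply] at hζ
  rw [Polynomial.coe_mul, Polynomial.coe_C]
  simp only [Algebra.algebraMap_self, RingHom.id_apply] at hζ
  linear_combination hζ

end Kummer

/-! ### Pochhammer quotients modulo `p`. -/

/-- The subring of `ℚ` of `p`-integral rational numbers. -/
def pInt (p : ℕ) [Fact p.Prime] : Subring ℚ where
  carrier := {q | ¬ p ∣ q.den}
  mul_mem' {a b} ha hb h := by
    rcases (Fact.out : p.Prime).dvd_mul.1 (h.trans (Rat.mul_den_dvd a b)) with h | h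
    exacts [ha h, hb h]
  add_mem' {a b} ha hb h := by
    rcases (Fact.out : p.Prime).dvd_mul.1 (h.trans (Rat.add_den_dvd a b)) with h | h
    exacts [ha h, hb h]
  one_mem' := by simpa using (Fact.out : p.Prime).one_lt.ne'
  zero_mem' := by simpa using (Fact.out : p.Prime).one_lt.ne'
  neg_mem' {a} ha := by simpa using ha

section

variable {p : ℕ} [Fact p.Prime]

theorem mem_pInt {q : ℚ} : q ∈ pInt p ↔ ¬ p ∣ q.den := Iff.rfl

theorem den_cast_ne_zero {q : ℚ} (hq : q ∈ pInt p) : (q.den : ZMod p) ≠ 0 := by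
  rwa [Ne, ZMod.natCast_eq_zero_iff]

theorem cast_mul_pInt {x y : ℚ} (hx : x ∈ pInt p) (hy : y ∈ pInt p) :
    ((x * y : ℚ) : ZMod p) = x * y :=
  Rat.cast_mul_of_ne_zero (den_cast_ne_zero hx) (den_cast_ne_zero hy)

theorem cast_add_pInt {x y : ℚ} (hx : x ∈ pInt p) (hy : y ∈ pInt p) :
    ((x + y : ℚ) : ZMod p) = x + y :=
  Rat.cast_add_of_ne_zero (den_cast_ne_zero hx) (den_cast_ne_zero hy)

/-- Reduction modulo `p` of `p`-integral rational numbers. -/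
def red (p : ℕ) [Fact p.Prime] : pInt p →+* ZMod p where
  toFun q := ((q : ℚ) : ZMod p)
  map_one' := by simp
  map_zero' := by simp
  map_mul' x y := cast_mul_pInt x.2 y.2
  map_add' x y := cast_add_pInt x.2 y.2

theorem cast_prod_pInt {s : Finset ℕ} {x : ℕ → ℚ} (hx : ∀ j, x j ∈ pInt p) :
    ((∏ j ∈ s, x j : ℚ) : ZMod p) = ∏ j ∈ s, ((x j : ℚ) : ZMod p) := by
  have h := map_prod (red p) (fun j => (⟨x j, hx j⟩ : pInt p)) s
  have h2 : ((∏ j ∈ s, (⟨x j, hx j⟩ : pInt p) : pInt p) : ℚ) = ∏ j ∈ s, x j := by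
    rw [SubmonoidClass.coe_finsetProd]
  rw [← h2]
  exact h

theorem inv_mem_pInt {x : ℚ} (hx : x ∈ pInt p) (h0 : (x : ZMod p) ≠ 0) :
    x⁻¹ ∈ pInt p ∧ ((x⁻¹ : ℚ) : ZMod p) = (x : ZMod p)⁻¹ := by
  have hnum : (x.num : ZMod p) ≠ 0 := by
    intro h
    rw [Rat.cast_def, h, zero_div] at h0
    exact h0 rfl
  refine ⟨?_, Rat.cast_inv_of_ne_zero hnum⟩
  have hx0 : x ≠ 0 := by rintro rfl; simp at h0
  rw [mem_pInt, Rat.den_inv_of_ne_zero hx0, ← Int.natCast_dvd]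
  rwa [Ne, ZMod.intCast_zmod_eq_zero_iff_dvd] at hnum

theorem natCast_mem_pInt (n : ℕ) : (n : ℚ) ∈ pInt p := natCast_mem _ n

/-- The Pochhammer product `∏_{j < n} (α + j)` over `ℚ`. -/
def rising (α : ℚ) (n : ℕ) : ℚ := ∏ j ∈ Finset.range n, (α + j)

/-- The part of `rising α n` prime to `p`, when `p ∣ α + j` exactly for `j ≡ k`. -/
def risingUnit (p : ℕ) (α : ℚ) (k n : ℕ) : ℚ :=
  ∏ j ∈ Finset.range n, if j % p = k then 1 else α + j

theorem rising_pos {α : ℚ} (hα : 0 < α) (n : ℕ) : 0 < rising α n :=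
  Finset.prod_pos fun j _ => by positivity

theorem rising_succ (α : ℚ) (n : ℕ) : rising α (n + 1) = rising α n * (α + n) :=
  Finset.prod_range_succ _ _

/-- The factors with `j = k + p i` equal `p * (α + i)` and so rebuild a shorter Pochhammer product
with the same `α`. The quotient `(n + (p - 1 - k)) / p` counts the `j < n` congruent to `k`. -/
theorem rising_eq {α : ℚ} {k : ℕ} (hk : k < p) (hα : α + k = p * α) (n : ℕ) :
    rising α n = risingUnit p α k n * p ^ ((n + (p - 1 - k)) / p) *
      rising α ((n + (p - 1 - k)) / p) := by
  have hp := (Fact.out : p.Prime).pos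
  induction n with
  | zero =>
    have : (0 + (p - 1 - k)) / p = 0 := Nat.div_eq_of_lt (by omega)
    rw [this]
    simp [rising, risingUnit]
  | succ n ih =>
    have h1 : (n + 1 + (p - 1 - k)) / p =
        (n + (p - 1 - k)) / p + if n % p = k then 1 else 0 := by
      have h2 : n + 1 + (p - 1 - k) = (n + (p - 1 - k)) + 1 := by ring
      rw [h2, Nat.succ_div]
      congr 1
      have h3 : p ∣ n + (p - 1 - k) + 1 ↔ n % p = k := by
        have h4 : n + (p - 1 - k) + 1 = p * (n / p) + (n % p + (p - k)) := by
          have := Nat.div_add_mod n p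
          omega
        rw [h4, Nat.dvd_add_right (dvd_mul_right _ _)]
        have h5 := Nat.mod_lt n hp
        constructor
        · rintro ⟨c, hc⟩
          have : c = 1 := by
            rcases c with _ | _ | c
            · omega
            · rfl
            · exfalso
              have h6 : p * 2 ≤ p * (c + 1 + 1) := Nat.mul_le_mul_left p (by omega)
              omega
          subst this
          omega
        · rintro rfl
          exact ⟨1, by omega⟩
      simp only [h3]
    rw [rising_succ, ih, h1, risingUnit, risingUnit, Finset.prod_range_succ]
    by_cases h : n % p = k
    · rw [if_pos h, if_pos h]
      have h3 : (n + (p - 1 - k)) / p = n / p := by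
        have h4 : n + (p - 1 - k) = p * (n / p) + (p - 1) := by
          have := Nat.div_add_mod n p
          omega
        rw [h4, Nat.mul_add_div hp, Nat.div_eq_of_lt (a := p - 1) (by omega), add_zero]
      rw [h3, rising_succ, pow_succ]
      have h5 : (n : ℚ) = p * (n / p : ℕ) + k := by
        have := Nat.div_add_mod n p
        rw [h] at this
        exact_mod_cast this.symm
      have h6 : α + n = p * (α + (n / p : ℕ)) := by rw [h5]; linear_combination hα
      rw [h6]
      ring
    · rw [if_neg h, if_neg h, add_zero]; ring

theorem digit_div {k a b : ℕ} (hk : k < p) (hb : b < p) :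
    (a * p + b + (p - 1 - k)) / p = a + if k < b then 1 else 0 := by
  have hp := (Fact.out : p.Prime).pos
  rw [add_assoc, mul_comm a p, Nat.mul_add_div hp]
  congr 1
  split_ifs with h
  · exact Nat.div_eq_of_lt_le (by omega) (by omega)
  · exact Nat.div_eq_of_lt (by omega)

/-- The identity off `0`, sending `0` to `1`. -/
def offZero (x : ZMod p) : ZMod p := if x = 0 then 1 else x

theorem offZero_ne_zero (x : ZMod p) : offZero x ≠ 0 := by
  unfold offZero; split_ifs with h
  · exact one_ne_zero
  · exact h

theorem cast_add_natCast {α : ℚ} {k : ℕ} (hα : α + k = p * α) (hαp : α ∈ pInt p) (j : ℕ) :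
    ((α + j : ℚ) : ZMod p) = j - k := by
  have h1 : ((α + k : ℚ) : ZMod p) = 0 := by
    rw [hα, cast_mul_pInt (natCast_mem_pInt p) hαp]; simp
  rw [cast_add_pInt hαp (natCast_mem_pInt _)] at h1 ⊢
  simp only [Rat.cast_natCast] at h1 ⊢
  linear_combination h1

theorem cast_risingUnit {α : ℚ} {k : ℕ} (hk : k < p) (hα : α + k = p * α) (hαp : α ∈ pInt p)
    (n : ℕ) : risingUnit p α k n ∈ pInt p ∧
      ((risingUnit p α k n : ℚ) : ZMod p) = ∏ j ∈ Finset.range n, offZero (j - k : ZMod p) := by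
  have h1 : ∀ j : ℕ, (if j % p = k then 1 else α + j : ℚ) ∈ pInt p := fun j => by
    split_ifs
    · exact one_mem _
    · exact add_mem hαp (natCast_mem_pInt _)
  refine ⟨prod_mem fun j _ => h1 j, ?_⟩
  rw [risingUnit, cast_prod_pInt h1]
  refine Finset.prod_congr rfl fun j _ => ?_
  have h2 : (j : ZMod p) - k = 0 ↔ j % p = k := by
    rw [sub_eq_zero, ZMod.natCast_eq_natCast_iff, Nat.ModEq, Nat.mod_eq_of_lt hk]
  unfold offZero
  by_cases h : j % p = k
  · rw [if_pos h, if_pos (h2.2 h)]; simp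
  · rw [if_neg h, if_neg (mt h2.1 h), cast_add_natCast hα hαp]

/-- A block of `p` consecutive integers meets every residue once, so the shift by `k` is invisible.
Full blocks therefore cancel between `α` and `β`. -/
theorem prod_range_offZero (k : ℕ) :
    ∏ j ∈ Finset.range p, offZero (j - k : ZMod p) = ∏ x : ZMod p, offZero x := by
  rw [← (Equiv.subRight (k : ZMod p)).prod_comp]
  refine Finset.prod_nbij' (fun j => (j : ZMod p)) ZMod.val (by simp) ?_ ?_ (by simp) (by simp)
  · intro x _; simpa using ZMod.val_lt x
  · intro j hj; exact ZMod.val_cast_of_lt (by simpa using hj)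

theorem prod_range_mul_add_offZero (k a b : ℕ) :
    ∏ j ∈ Finset.range (a * p + b), offZero (j - k : ZMod p) =
      (∏ x : ZMod p, offZero x) ^ a * ∏ j ∈ Finset.range b, offZero (j - k : ZMod p) := by
  induction a with
  | zero => simp
  | succ a ih =>
    have : (a + 1) * p + b = p + (a * p + b) := by ring
    rw [this, Finset.prod_range_add, prod_range_offZero]
    simp only [Nat.cast_add, CharP.cast_eq_zero, zero_add]
    rw [ih]; ring

/-- The data attached to a quotient `(α)ₙ / (β)ₙ` at a prime `p`: the first indices `k < l` for
which `α + k` and `β + l` are divisible by `p`, both quotients being `α` and `β` again. -/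
structure PairData (p : ℕ) [Fact p.Prime] (α β : ℚ) (k l : ℕ) : Prop where
  α_pos : 0 < α
  β_pos : 0 < β
  α_mem : α ∈ pInt p
  β_mem : β ∈ pInt p
  hα : α + k = p * α
  hβ : β + l = p * β
  hkl : k < l
  hl : l < p

/-- The quotient `(α)ₙ / (β)ₙ`. -/
def pairSeq (α β : ℚ) (n : ℕ) : ℚ := rising α n / rising β n

theorem pairSeq_zero (α β : ℚ) : pairSeq α β 0 = 1 := by simp [pairSeq, rising]

namespace PairData

variable {α β : ℚ} {k l : ℕ} (H : PairData p α β k l)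

include H

theorem risingUnit_β_ne_zero (n : ℕ) : risingUnit p β l n ≠ 0 := by
  refine Finset.prod_ne_zero_iff.2 fun j _ => ?_
  have := H.β_pos
  split_ifs <;> positivity

theorem unit_mem (n : ℕ) : risingUnit p α k n / risingUnit p β l n ∈ pInt p ∧
    ((risingUnit p α k n / risingUnit p β l n : ℚ) : ZMod p) =
      (∏ j ∈ Finset.range n, offZero (j - k : ZMod p)) /
        ∏ j ∈ Finset.range n, offZero (j - l : ZMod p) := by
  obtain ⟨h1, h2⟩ := cast_risingUnit (H.hkl.trans H.hl) H.hα H.α_mem n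
  obtain ⟨h3, h4⟩ := cast_risingUnit H.hl H.hβ H.β_mem n
  have h5 : ((risingUnit p β l n : ℚ) : ZMod p) ≠ 0 := by
    rw [h4]; exact Finset.prod_ne_zero_iff.2 fun j _ => offZero_ne_zero _
  obtain ⟨h6, h7⟩ := inv_mem_pInt h3 h5
  rw [div_eq_mul_inv]
  refine ⟨mul_mem h1 h6, ?_⟩
  rw [cast_mul_pInt h1 h6, h7, h2, h4, div_eq_mul_inv]

theorem unit_periodic (a b : ℕ) :
    ((risingUnit p α k (a * p + b) / risingUnit p β l (a * p + b) : ℚ) : ZMod p) =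
      ((risingUnit p α k b / risingUnit p β l b : ℚ) : ZMod p) := by
  rw [(H.unit_mem _).2, (H.unit_mem _).2, prod_range_mul_add_offZero, prod_range_mul_add_offZero,
    mul_div_mul_left]
  exact pow_ne_zero _ (Finset.prod_ne_zero_iff.2 fun j _ => offZero_ne_zero _)

theorem pairSeq_low {a b : ℕ} (hb : b ≤ k) : pairSeq α β (a * p + b) =
    risingUnit p α k (a * p + b) / risingUnit p β l (a * p + b) * pairSeq α β a := by
  have h1 := H.hkl; have h2 := H.hl
  have hp : (p : ℚ) ≠ 0 := by exact_mod_cast (Fact.out : p.Prime).ne_zero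
  have h3 := H.risingUnit_β_ne_zero (a * p + b)
  have h4 := (rising_pos H.β_pos a).ne'
  rw [pairSeq, rising_eq (h1.trans h2) H.hα, rising_eq h2 H.hβ (a * p + b),
    digit_div (by omega) (by omega), digit_div h2 (by omega), if_neg (by omega),
    if_neg (by omega), pairSeq, add_zero]
  field_simp

/-- Between `k` and `l` the numerator has met one more multiple of `p` than the denominator; the
surplus factor makes the term vanish modulo `p`. -/
theorem pairSeq_mid {a b : ℕ} (hb : k < b) (hb' : b ≤ l) : pairSeq α β (a * p + b) =
    risingUnit p α k (a * p + b) / risingUnit p β l (a * p + b) *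
      (p * (α + a)) * pairSeq α β a := by
  have h1 := H.hkl; have h2 := H.hl
  have hp : (p : ℚ) ≠ 0 := by exact_mod_cast (Fact.out : p.Prime).ne_zero
  have h3 := H.risingUnit_β_ne_zero (a * p + b)
  have h4 := (rising_pos H.β_pos a).ne'
  rw [pairSeq, rising_eq (h1.trans h2) H.hα, rising_eq h2 H.hβ (a * p + b),
    digit_div (by omega) (by omega), digit_div h2 (by omega), if_pos (by omega),
    if_neg (by omega), pairSeq, add_zero, rising_succ, pow_succ]
  field_simp

theorem pairSeq_high {a b : ℕ} (hb : l < b) (hb' : b < p) : pairSeq α β (a * p + b) =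
    risingUnit p α k (a * p + b) / risingUnit p β l (a * p + b) * pairSeq α β (a + 1) := by
  have h1 := H.hkl; have h2 := H.hl
  have hp : (p : ℚ) ≠ 0 := by exact_mod_cast (Fact.out : p.Prime).ne_zero
  have h3 := H.risingUnit_β_ne_zero (a * p + b)
  have h4 := (rising_pos H.β_pos (a + 1)).ne'
  rw [pairSeq, rising_eq (h1.trans h2) H.hα, rising_eq h2 H.hβ (a * p + b),
    digit_div (by omega) (by omega), digit_div h2 (by omega), if_pos (by omega),
    if_pos (by omega), pairSeq]
  field_simp

theorem α_add_mem (a : ℕ) : (p * (α + a) : ℚ) ∈ pInt p ∧ ((p * (α + a) : ℚ) : ZMod p) = 0 := by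
  have h := add_mem H.α_mem (natCast_mem_pInt (p := p) a)
  exact ⟨mul_mem (natCast_mem_pInt _) h, by rw [cast_mul_pInt (natCast_mem_pInt _) h]; simp⟩

theorem pairSeq_mem (n : ℕ) : pairSeq α β n ∈ pInt p := by
  induction n using Nat.strong_induction_on with
  | _ n ih =>
  have hp := (Fact.out : p.Prime).one_lt
  rcases Nat.eq_zero_or_pos n with rfl | hn
  · rw [pairSeq_zero]; exact one_mem _
  have hmod := Nat.mod_lt n (by omega : 0 < p)
  have hdiv : n / p < n := Nat.div_lt_self hn hp
  have hkl := H.hkl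
  have hα := H.hα
  -- `k = 0` would give `α = p * α`. Positivity of `k` makes the last digit large enough in the high
  -- range for the induction to reach `n / p + 1 < n`.
  have hk0 : 0 < k := by
    rcases Nat.eq_zero_or_pos k with rfl | h
    · exfalso
      have h1 := H.α_pos
      have h2 : (1 : ℚ) < p := by exact_mod_cast hp
      simp only [Nat.cast_zero, add_zero] at hα
      nlinarith
    · exact h
  have hn' : n = n / p * p + n % p := (Nat.div_add_mod' n p).symm
  by_cases h1 : n % p ≤ k
  · rw [hn', H.pairSeq_low h1]
    exact mul_mem (H.unit_mem _).1 (ih _ hdiv)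
  by_cases h2 : n % p ≤ l
  · rw [hn', H.pairSeq_mid (by omega) h2]
    exact mul_mem (mul_mem (H.unit_mem _).1 (H.α_add_mem _).1) (ih _ hdiv)
  · have h3 : n / p + 1 < n := by
      have : n / p ≤ n / p * p := Nat.le_mul_of_pos_right _ (by omega)
      omega
    rw [hn', H.pairSeq_high (by omega) hmod]
    exact mul_mem (H.unit_mem _).1 (ih _ h3)

theorem pairSeq_cast_eq_zero {a b : ℕ} (hb : k < b) (hb' : b ≤ l) :
    ((pairSeq α β (a * p + b) : ℚ) : ZMod p) = 0 := by
  rw [H.pairSeq_mid hb hb',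
    cast_mul_pInt (mul_mem (H.unit_mem _).1 (H.α_add_mem _).1) (H.pairSeq_mem _),
    cast_mul_pInt (H.unit_mem _).1 (H.α_add_mem _).1, (H.α_add_mem _).2]
  simp

/-- The restriction on the digit matters: beyond `l` the higher part contributes its value at `a +
1` instead of `a`. -/
theorem pairSeq_lucas {a b : ℕ} (hb : b ≤ l) :
    ((pairSeq α β (a * p + b) : ℚ) : ZMod p) = pairSeq α β a * pairSeq α β b := by
  have key : ∀ {b : ℕ}, k < b → b ≤ l → ((pairSeq α β b : ℚ) : ZMod p) = 0 := fun h1 h2 => by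
    simpa using H.pairSeq_cast_eq_zero (a := 0) h1 h2
  by_cases h1 : b ≤ k
  · have h2 := H.pairSeq_low (a := 0) h1
    rw [zero_mul, zero_add, pairSeq_zero, mul_one] at h2
    rw [H.pairSeq_low h1, cast_mul_pInt (H.unit_mem _).1 (H.pairSeq_mem _), H.unit_periodic, h2,
      mul_comm]
  · rw [H.pairSeq_cast_eq_zero (by omega) hb, key (by omega) hb, mul_zero]

end PairData

end

/-! ### Lucas congruences. -/

section

variable {p : ℕ} [Fact p.Prime]

/-- A sequence of `p`-integral rationals satisfying the Lucas congruence modulo `p`. -/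
structure IsLucas (p : ℕ) [Fact p.Prime] (a : ℕ → ℚ) : Prop where
  mem : ∀ n, a n ∈ pInt p
  cast : ∀ m b, b < p → ((a (m * p + b) : ℚ) : ZMod p) = a m * a b

theorem IsLucas.mul {a b : ℕ → ℚ} (ha : IsLucas p a) (hb : IsLucas p b) :
    IsLucas p fun n => a n * b n := by
  refine ⟨fun n => mul_mem (ha.mem n) (hb.mem n), fun m d hd => ?_⟩
  simp only [cast_mul_pInt (ha.mem _) (hb.mem _), ha.cast m d hd, hb.cast m d hd]
  ring

theorem IsLucas.const_pow (c : ℕ) : IsLucas p fun n => (c : ℚ) ^ n := by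
  refine ⟨fun n => pow_mem (natCast_mem_pInt c) n, fun m d _ => ?_⟩
  have h : ∀ n : ℕ, (((c : ℚ) ^ n : ℚ) : ZMod p) = (c : ZMod p) ^ n := fun n => by
    rw [← Nat.cast_pow, Rat.cast_natCast, Nat.cast_pow]
  rw [h, h, h, pow_add, mul_comm m p, pow_mul, ZMod.pow_card]

theorem PairData.isLucas {α β : ℚ} {k : ℕ} (H : PairData p α β k (p - 1)) :
    IsLucas p (pairSeq α β) :=
  ⟨H.pairSeq_mem, fun _ _ hb => H.pairSeq_lucas (Nat.le_sub_one_of_lt hb)⟩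

/-- For digits above `l`, where the first factor need not obey the congruence, the second factor
vanishes modulo `p` because `k' ≤ l`. -/
theorem PairData.isLucas_mul {α β γ : ℚ} {k k' l : ℕ} (H : PairData p α β k l)
    (H' : PairData p γ 1 k' (p - 1)) (hk : k' ≤ l) :
    IsLucas p fun n => pairSeq α β n * pairSeq γ 1 n := by
  refine ⟨fun n => mul_mem (H.pairSeq_mem n) (H'.pairSeq_mem n), fun m d hd => ?_⟩
  simp only [cast_mul_pInt (H.pairSeq_mem _) (H'.pairSeq_mem _)]
  by_cases h : d ≤ l
  · rw [H.pairSeq_lucas h, H'.isLucas.cast m d hd]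
    ring
  · have h1 := H'.pairSeq_cast_eq_zero (a := m) (b := d) (by omega) (by omega)
    have h2 := H'.pairSeq_cast_eq_zero (a := 0) (b := d) (by omega) (by omega)
    rw [zero_mul, zero_add] at h2
    rw [h1, h2]
    ring

theorem sum_range_mul {M : Type*} [AddCommMonoid M] (F : ℕ → M) (A q : ℕ) :
    ∑ k ∈ Finset.range (A * q), F k =
      ∑ c ∈ Finset.range A, ∑ d ∈ Finset.range q, F (c * q + d) := by
  induction A with
  | zero => simp
  | succ A ih => rw [Nat.succ_mul, Finset.sum_range_add, ih, Finset.sum_range_succ]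

theorem choose_cast_lucas {a b c d : ℕ} (hb : b < p) (hd : d < p) :
    ((a * p + b).choose (c * p + d) : ZMod p) = b.choose d * a.choose c := by
  have hp := (Fact.out : p.Prime).pos
  have h := Choose.choose_modEq_choose_mod_mul_choose_div_nat (p := p) (n := a * p + b)
    (k := c * p + d)
  rw [← ZMod.natCast_eq_natCast_iff] at h
  have e : ∀ {x y : ℕ}, y < p → (x * p + y) / p = x := fun {x y} hy => by
    rw [mul_comm, Nat.mul_add_div hp, Nat.div_eq_of_lt hy, add_zero]
  rw [h, Nat.mul_add_mod_of_lt hb, Nat.mul_add_mod_of_lt hd, e hb, e hd, Nat.cast_mul]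

/-- The Apéry numbers. -/
def apery (n : ℕ) : ℕ :=
  ∑ k ∈ Finset.range (n + 1), n.choose k ^ 2 * (n + k).choose k ^ 2

theorem apery_eq_sum_range {n N : ℕ} (h : n < N) :
    apery n = ∑ k ∈ Finset.range N, n.choose k ^ 2 * (n + k).choose k ^ 2 := by
  refine Finset.sum_subset (Finset.range_mono h) fun k _ hk => ?_
  rw [Nat.choose_eq_zero_of_lt (by simpa using hk)]
  simp

/-- If adding the last digits produces a carry, both sides vanish: the last digit of the sum is then
smaller than `d`. -/
theorem choose_add_cast_lucas {a b c d : ℕ} (hb : b < p) (hd : d < p) :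
    ((a * p + b + (c * p + d)).choose (c * p + d) : ZMod p) =
      (b + d).choose d * (a + c).choose c := by
  by_cases h : b + d < p
  · rw [← choose_cast_lucas h hd]
    congr 2
    ring
  · have e1 : a * p + b + (c * p + d) = (a + c + 1) * p + (b + d - p) := by
      have : (a + c + 1) * p = a * p + c * p + p := by ring
      omega
    have e2 : b + d = 1 * p + (b + d - p) := by omega
    have e3 : d = 0 * p + d := by omega
    have h0 : (b + d - p).choose d = 0 := Nat.choose_eq_zero_of_lt (by omega)
    have h1 : ((b + d).choose d : ZMod p) = 0 := by
      have := choose_cast_lucas (p := p) (a := 1) (b := b + d - p) (c := 0) (d := d)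
        (by omega) hd
      rw [← e2, zero_mul, zero_add, h0] at this
      simpa using this
    rw [e1, choose_cast_lucas (by omega) hd, h0, h1]
    simp

theorem isLucas_apery : IsLucas p fun n => (apery n : ℚ) := by
  refine ⟨fun n => natCast_mem_pInt _, fun m b hb => ?_⟩
  simp only [Rat.cast_natCast]
  -- The extra terms are zero, so the range can be extended to whole blocks and the double sum
  -- factors.
  have h1 : m * p + b < (m + 1) * p := by
    rw [Nat.succ_mul]; omega
  rw [apery_eq_sum_range h1, sum_range_mul, apery_eq_sum_range hb, apery]
  push_cast
  rw [Finset.sum_mul_sum]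
  refine Finset.sum_congr rfl fun c _ => Finset.sum_congr rfl fun d hd => ?_
  have hd' := Finset.mem_range.1 hd
  rw [choose_cast_lucas hb hd', choose_add_cast_lucas hb hd']
  ring

end

/-! ### The four coefficient sequences. -/

/-- The coefficients of `MixedExample.f`, as rational numbers. -/
def seqF (n : ℕ) : ℚ := (64 : ℕ) ^ n * (pairSeq (1 / 4) 1 n * pairSeq (3 / 4) 1 n)

/-- The coefficients of `MixedExample.g`, as rational numbers. -/
def seqG (n : ℕ) : ℚ := apery n

/-- The coefficients of `MixedExample.h`, as rational numbers. -/
def seqH (n : ℕ) : ℚ := pairSeq (1 / 6) (2 / 3) n * pairSeq (1 / 2) 1 n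

/-- The coefficients of `MixedExample.i`, as rational numbers. -/
def seqI (n : ℕ) : ℚ := pairSeq (1 / 5) (2 / 7) n * pairSeq (1 / 5) 1 n * pairSeq (1 / 5) 1 n

theorem not_dvd_of_lt {p n : ℕ} (hn : 0 < n) (h : n < p) : ¬ p ∣ n :=
  fun hd => (Nat.le_of_dvd hn hd).not_gt h

/-- Since `p - 1 = 420 t`, the index with `α + k = p * α` is `k = (p - 1) * α`, an integer when the
denominator of `α` divides 420. -/
theorem pairData_one {p t : ℕ} [Fact p.Prime] (hp : p = 420 * t + 1) {α : ℚ} {k : ℕ}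
    (hα0 : 0 < α) (hk : (k : ℚ) = 420 * α * t) (hkp : k < 420 * t) (hden : α.den < 420) :
    PairData p α 1 k (p - 1) := by
  have ht : 0 < t := by
    rcases Nat.eq_zero_or_pos t with rfl | h
    · exact absurd (Fact.out : p.Prime) (by rw [hp]; norm_num)
    · exact h
  refine ⟨hα0, one_pos, ?_, one_mem _, ?_, ?_, by omega, by omega⟩
  · exact not_dvd_of_lt α.den_pos (by omega)
  · rw [hk, hp]; push_cast; ring
  · rw [hp]; push_cast; ring

theorem pairData_of {p t : ℕ} [Fact p.Prime] (hp : p = 420 * t + 1) {α β : ℚ} {k l : ℕ}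
    (hα0 : 0 < α) (hk : (k : ℚ) = 420 * α * t) (hden : α.den < 420)
    (hβ0 : 0 < β) (hl : (l : ℚ) = 420 * β * t) (hlp : l < 420 * t) (hden' : β.den < 420)
    (hkl : k < l) : PairData p α β k l := by
  have h1 := pairData_one hp hα0 hk (hkl.trans hlp) hden
  have h2 := pairData_one hp hβ0 hl hlp hden'
  exact ⟨hα0, hβ0, h1.α_mem, h2.α_mem, h1.hα, h2.hα, hkl, by omega⟩

/-- At a prime `p ≡ 1` modulo `420` all four sequences satisfy the Lucas congruence. -/
theorem isLucas_seq {p t : ℕ} [Fact p.Prime] (hp : p = 420 * t + 1) :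
    IsLucas p seqF ∧ IsLucas p seqG ∧ IsLucas p seqH ∧ IsLucas p seqI := by
  have ht : 0 < t := by
    rcases Nat.eq_zero_or_pos t with rfl | h
    · exact absurd (Fact.out : p.Prime) (by rw [hp]; norm_num)
    · exact h
  have d4 : (1 / 4 : ℚ).den < 420 := by norm_num
  have d34 : (3 / 4 : ℚ).den < 420 := by norm_num
  have d2 : (1 / 2 : ℚ).den < 420 := by norm_num
  have d5 : (1 / 5 : ℚ).den < 420 := by norm_num
  have d6 : (1 / 6 : ℚ).den < 420 := by norm_num
  have d23 : (2 / 3 : ℚ).den < 420 := by norm_num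
  have d27 : (2 / 7 : ℚ).den < 420 := by norm_num
  have q4 : PairData p (1 / 4) 1 (105 * t) (p - 1) :=
    pairData_one hp (by norm_num) (by push_cast; ring) (by omega) d4
  have q34 : PairData p (3 / 4) 1 (315 * t) (p - 1) :=
    pairData_one hp (by norm_num) (by push_cast; ring) (by omega) d34
  have q2 : PairData p (1 / 2) 1 (210 * t) (p - 1) :=
    pairData_one hp (by norm_num) (by push_cast; ring) (by omega) d2
  have q5 : PairData p (1 / 5) 1 (84 * t) (p - 1) :=
    pairData_one hp (by norm_num) (by push_cast; ring) (by omega) d5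
  have q6 : PairData p (1 / 6) (2 / 3) (70 * t) (280 * t) :=
    pairData_of hp (by norm_num) (by push_cast; ring) d6 (by norm_num) (by push_cast; ring)
      (by omega) d23 (by omega)
  have q57 : PairData p (1 / 5) (2 / 7) (84 * t) (120 * t) :=
    pairData_of hp (by norm_num) (by push_cast; ring) d5 (by norm_num) (by push_cast; ring)
      (by omega) d27 (by omega)
  exact ⟨(IsLucas.const_pow 64).mul (q4.isLucas.mul q34.isLucas), isLucas_apery,
    q6.isLucas_mul q2 (by omega), (q57.isLucas_mul q5 (by omega)).mul q5.isLucas⟩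

theorem rising_one (n : ℕ) : rising 1 n = n ! := by
  induction n with
  | zero => simp [rising]
  | succ n ih => rw [rising_succ, ih, Nat.factorial_succ]; push_cast; ring

theorem poch_eq_rising (α : ℚ) (n : ℕ) : MixedExample.poch α n = (rising α n : ℚ) := by
  induction n with
  | zero => simp [MixedExample.poch, rising]
  | succ n ih =>
    rw [MixedExample.poch, ascPochhammer_succ_eval, rising_succ, Rat.cast_mul, ← ih,
      MixedExample.poch]
    push_cast
    ring

theorem four_mul_factorial (n : ℕ) :
    ((4 * n)! : ℚ) = 64 ^ n * rising (1 / 4) n * rising (3 / 4) n * (2 * n)! := by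
  induction n with
  | zero => simp [rising]
  | succ n ih =>
    rw [show 4 * (n + 1) = 4 * n + 1 + 1 + 1 + 1 by ring, show 2 * (n + 1) = 2 * n + 1 + 1 by ring]
    simp only [Nat.factorial_succ, rising_succ]
    push_cast
    rw [ih]
    ring

theorem coe_mk_eq {a : ℕ → ℚ} {b : ℕ → ℂ} (h : ∀ n, b n = (a n : ℚ)) :
    PowerSeries.mk b = PowerSeries.map (algebraMap ℚ ℂ) (PowerSeries.mk a) := by
  ext n
  simp [h]

theorem f_eq : MixedExample.f = PowerSeries.map (algebraMap ℚ ℂ) (PowerSeries.mk seqF) := by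
  refine coe_mk_eq fun n => ?_
  rw [seqF, pairSeq, pairSeq, rising_one]
  have h := congrArg (Rat.cast : ℚ → ℂ) (four_mul_factorial n)
  have h1 : ((2 * n)! : ℂ) ≠ 0 := by exact_mod_cast Nat.factorial_ne_zero _
  have h2 : (n ! : ℂ) ≠ 0 := by exact_mod_cast Nat.factorial_ne_zero _
  push_cast at h ⊢
  rw [h]
  field_simp

theorem g_eq : MixedExample.g = PowerSeries.map (algebraMap ℚ ℂ) (PowerSeries.mk seqG) :=
  coe_mk_eq fun n => by simp [seqG, apery]

theorem h_eq : MixedExample.h = PowerSeries.map (algebraMap ℚ ℂ) (PowerSeries.mk seqH) := by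
  refine coe_mk_eq fun n => ?_
  have h1 := poch_eq_rising (1 / 6) n
  have h2 := poch_eq_rising (1 / 2) n
  have h3 := poch_eq_rising (2 / 3) n
  push_cast at h1 h2 h3
  rw [seqH, pairSeq, pairSeq, rising_one, h1, h2, h3]
  push_cast
  rw [div_mul_div_comm]

theorem i_eq : MixedExample.i = PowerSeries.map (algebraMap ℚ ℂ) (PowerSeries.mk seqI) := by
  refine coe_mk_eq fun n => ?_
  have h1 := poch_eq_rising (1 / 5) n
  have h3 := poch_eq_rising (2 / 7) n
  push_cast at h1 h3
  rw [seqI, pairSeq, pairSeq, rising_one, h1, h3]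
  push_cast
  rw [div_mul_div_comm, div_mul_div_comm]
  congr 1 <;> ring

/-! ### The Frobenius equation of a Lucas series. -/

section Frobenius

variable {p : ℕ} [Fact p.Prime]

theorem expand_eq_pow (w : PowerSeries (ZMod p)) (hp : p ≠ 0) :
    PowerSeries.expand p hp w = w ^ p := by
  have h := MvPowerSeries.map_frobenius_expand (R := ZMod p) p hp (f := w)
  rw [ZMod.frobenius_zmod] at h
  exact h

/-- The reduction modulo `p` of a Lucas series satisfies `w = A * w ^ p` with `A` a truncation. -/
theorem IsLucas.eq_trunc_mul_pow {a : ℕ → ℚ} (ha : IsLucas p a) :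
    (PowerSeries.mk fun n => (a n : ZMod p)) =
      (PowerSeries.trunc p (PowerSeries.mk fun n => (a n : ZMod p)) : PowerSeries (ZMod p)) *
        (PowerSeries.mk fun n => (a n : ZMod p)) ^ p := by
  have hp := (Fact.out : p.Prime)
  rw [← expand_eq_pow _ hp.ne_zero]
  ext n
  have hn := Nat.div_add_mod' n p
  have hlt := Nat.mod_lt n hp.pos
  rw [PowerSeries.coeff_mul, PowerSeries.coeff_mk,
    Finset.sum_eq_single (n % p, p * (n / p))]
  · rw [Polynomial.coeff_coe, PowerSeries.coeff_trunc, if_pos hlt, PowerSeries.coeff_expand_mul,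
      PowerSeries.coeff_mk, PowerSeries.coeff_mk, mul_comm, ← ha.cast _ _ hlt, hn]
  · rintro ⟨i, j⟩ hij hne
    rw [Finset.HasAntidiagonal.mem_antidiagonal] at hij
    rw [Polynomial.coeff_coe, PowerSeries.coeff_trunc]
    split_ifs with hi
    · rw [PowerSeries.coeff_expand_of_not_dvd, mul_zero]
      rintro ⟨c, rfl⟩
      apply hne
      simp only at hij
      have h1 : n % p = i := by rw [← hij, Nat.add_mul_mod_self_left, Nat.mod_eq_of_lt hi]
      have h2 : n / p = c := by
        rw [← hij, Nat.add_mul_div_left _ _ hp.pos, Nat.div_eq_of_lt hi, zero_add]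
      rw [h1, h2]
    · rw [zero_mul]
  · intro h
    exact absurd (Finset.HasAntidiagonal.mem_antidiagonal.2 (by rw [add_comm, mul_comm]; exact hn)) h

end Frobenius

/-! ### From infinitely many primes back to the rationals. -/

section LinearAlgebra

theorem exists_forall_mem_pInt (s : Finset ℚ) :
    ∃ N : ℕ, ∀ (p : ℕ) [Fact p.Prime], N < p → ∀ q ∈ s, q ∈ pInt p := by
  refine ⟨∑ q ∈ s, q.den, fun p _ hp q hq => ?_⟩
  exact not_dvd_of_lt q.den_pos
    ((Finset.single_le_sum (f := fun q : ℚ => q.den) (fun _ _ => Nat.zero_le _) hq).trans_lt hp)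

/-- A homogeneous linear system over `ℚ` with nonzero solutions modulo infinitely many primes has
a nonzero solution. -/
theorem exists_rat_solution {κ : Type*} [Fintype κ] (v : ℕ → κ → ℚ)
    (hv : ∀ N : ℕ, ∃ p : ℕ, ∃ _ : Fact p.Prime, N < p ∧ (∀ n j, v n j ∈ pInt p) ∧
      ∃ x : κ → ZMod p, x ≠ 0 ∧ ∀ n, ∑ j, (v n j : ZMod p) * x j = 0) :
    ∃ x : κ → ℚ, x ≠ 0 ∧ ∀ n, ∑ j, v n j * x j = 0 := by
  classical
  -- If the rows span, each unit vector is a finite rational combination of rows. Modulo a prime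
  -- beyond all denominators involved, these combinations force every solution to be zero. If they
  -- do not span, a functional killing the rows is a solution.
  by_cases htop : Submodule.span ℚ (Set.range v) = ⊤
  · exfalso
    have hc : ∀ j : κ, ∃ c : ℕ →₀ ℚ, (c.sum fun n a => a • v n) = Pi.single j 1 := fun j => by
      have : (Pi.single j 1 : κ → ℚ) ∈ Submodule.span ℚ (Set.range v) := by
        rw [htop]; trivial
      exact Finsupp.mem_span_range_iff_exists_finsupp.1 this
    choose c hc using hc
    obtain ⟨N, hN⟩ := exists_forall_mem_pInt
      (Finset.univ.biUnion fun j => (c j).support.image (c j))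
    obtain ⟨p, hp, hNp, hvp, x, hx0, hx⟩ := hv N
    refine hx0 (funext fun j => ?_)
    have hcp : ∀ n, c j n ∈ pInt p := fun n => by
      by_cases h : n ∈ (c j).support
      · exact hN p hNp _ (Finset.mem_biUnion.2
          ⟨j, Finset.mem_univ _, Finset.mem_image_of_mem _ h⟩)
      · rw [Finsupp.notMem_support_iff.1 h]; exact zero_mem _
    have hred : ∀ k, ∑ n ∈ (c j).support, (c j n : ZMod p) * (v n k : ZMod p) =
        ((Pi.single j 1 : κ → ℚ) k : ZMod p) := fun k => by
      have h1 := congrFun (hc j) k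
      rw [Finsupp.sum, Finset.sum_apply] at h1
      simp only [Pi.smul_apply, smul_eq_mul] at h1
      have hmem : (Pi.single j 1 : κ → ℚ) k ∈ pInt p := by
        rw [← h1]
        exact sum_mem fun n _ => mul_mem (hcp n) (hvp n k)
      have h2 : ∑ n ∈ (c j).support, (⟨c j n, hcp n⟩ : pInt p) * ⟨v n k, hvp n k⟩ =
          ⟨(Pi.single j 1 : κ → ℚ) k, hmem⟩ := by
        apply Subtype.ext
        refine Eq.trans ?_ h1
        simp
      have h3 := congrArg (red p) h2
      rw [map_sum] at h3
      simp only [map_mul] at h3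
      exact h3
    have h4 : ∑ n ∈ (c j).support, (c j n : ZMod p) * ∑ k, (v n k : ZMod p) * x k = 0 :=
      Finset.sum_eq_zero fun n _ => by rw [hx n, mul_zero]
    simp only [Finset.mul_sum, ← mul_assoc] at h4
    rw [Finset.sum_comm] at h4
    simp only [← Finset.sum_mul, hred] at h4
    rw [Finset.sum_eq_single j (fun k _ hk => by rw [Pi.single_eq_of_ne hk]; simp) (by simp)] at h4
    simpa using h4
  · obtain ⟨g, hg0, hg⟩ := Submodule.exists_le_ker_of_lt_top _ (lt_top_iff_ne_top.2 htop)
    refine ⟨fun j => g (Pi.single j 1), fun h => hg0 ?_, fun n => ?_⟩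
    · refine LinearMap.pi_ext fun j q => ?_
      have h1 := congrFun h j
      have h2 : (Pi.single j q : κ → ℚ) = q • Pi.single j 1 := by
        rw [← Pi.single_smul]; simp
      rw [h2, map_smul, h1]
      simp
    · have h1 : g (v n) = 0 := hg (Submodule.subset_span ⟨n, rfl⟩)
      rw [LinearMap.pi_apply_eq_sum_univ] at h1
      rw [← h1]
      refine Finset.sum_congr rfl fun j _ => ?_
      have h2 : (fun k => if j = k then 1 else 0 : κ → ℚ) = Pi.single j 1 := by
        ext k; simp [Pi.single_apply, eq_comm]
      rw [smul_eq_mul, h2]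

end LinearAlgebra

section Transfer

variable {ι : Type*} [Fintype ι]

theorem coeff_coe_mul {R : Type*} [CommRing R] {P : Polynomial R} {N : ℕ} (hP : natDegree P ≤ N)
    (w : PowerSeries R) (n : ℕ) :
    PowerSeries.coeff n ((P : PowerSeries R) * w) =
      ∑ i : Fin (N + 1), PowerSeries.coeff n (PowerSeries.X ^ (i : ℕ) * w) * P.coeff i := by
  conv_lhs => rw [Polynomial.as_sum_range_C_mul_X_pow' P (Nat.lt_succ_of_le hP)]
  rw [Fin.sum_univ_eq_sum_range
    (fun i => PowerSeries.coeff n (PowerSeries.X ^ i * w) * P.coeff i) (N + 1)]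
  have h := map_sum (Polynomial.coeToPowerSeries.ringHom (R := R))
    (fun i => Polynomial.C (P.coeff i) * Polynomial.X ^ i) (Finset.range (N + 1))
  simp only [Polynomial.coeToPowerSeries.ringHom_apply] at h
  rw [Nat.succ_eq_add_one, h, Finset.sum_mul, map_sum]
  refine Finset.sum_congr rfl fun i _ => ?_
  rw [Polynomial.coe_mul, Polynomial.coe_pow, Polynomial.coe_X, Polynomial.coe_C, mul_assoc,
    PowerSeries.coeff_C_mul, mul_comm]

/-- The series with coefficients `a` over the `p`-integral rationals. -/
noncomputable def intSeries (p : ℕ) [Fact p.Prime] {a : ℕ → ℚ} (ha : ∀ n, a n ∈ pInt p) :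
    PowerSeries (pInt p) :=
  PowerSeries.mk fun n => ⟨a n, ha n⟩

theorem map_subtype_intSeries {p : ℕ} [Fact p.Prime] {a : ℕ → ℚ} (ha : ∀ n, a n ∈ pInt p) :
    PowerSeries.map (pInt p).subtype (intSeries p ha) = PowerSeries.mk a := by
  ext n; simp [intSeries]

theorem map_red_intSeries {p : ℕ} [Fact p.Prime] {a : ℕ → ℚ} (ha : ∀ n, a n ∈ pInt p) :
    PowerSeries.map (red p) (intSeries p ha) = PowerSeries.mk fun n => (a n : ZMod p) := by
  ext n; simp [intSeries, red]

theorem coeff_monom_red {p : ℕ} [Fact p.Prime] {a : ι → ℕ → ℚ} (ha : ∀ i n, a i n ∈ pInt p)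
    (m : ι → ℕ) (j n : ℕ) :
    PowerSeries.coeff n (PowerSeries.X ^ j * monom (fun i => PowerSeries.mk (a i)) m) ∈ pInt p ∧
      ((PowerSeries.coeff n (PowerSeries.X ^ j * monom (fun i => PowerSeries.mk (a i)) m) : ℚ) :
          ZMod p) =
        PowerSeries.coeff n (PowerSeries.X ^ j *
          monom (fun i => PowerSeries.mk fun n => (a i n : ZMod p)) m) := by
  have h1 := map_monom (PowerSeries.map (pInt p).subtype) (fun i => intSeries p (ha i)) m
  have h2 := map_monom (PowerSeries.map (red p)) (fun i => intSeries p (ha i)) m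
  simp only [map_subtype_intSeries] at h1
  simp only [map_red_intSeries] at h2
  rw [← h1, ← h2]
  have h3 : ∀ {S : Type} [CommRing S] (e : pInt p →+* S) (w : PowerSeries (pInt p)),
      PowerSeries.coeff n (PowerSeries.X ^ j * PowerSeries.map e w) =
        e (PowerSeries.coeff n (PowerSeries.X ^ j * w)) := fun e w => by
    rw [← PowerSeries.coeff_map, map_mul (PowerSeries.map e), map_pow (PowerSeries.map e),
      PowerSeries.map_X]
  rw [h3, h3]
  exact ⟨SetLike.coe_mem _, rfl⟩

/-- If the ratio of two monomials is rational of bounded height modulo infinitely many primes, it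
is rational. -/
theorem exists_rat_ratio {a : ι → ℕ → ℚ} (ha0 : ∀ i, a i 0 = 1) (m m' : ι → ℕ) (B : ℕ)
    (h : ∀ N : ℕ, ∃ p : ℕ, ∃ _ : Fact p.Prime, N < p ∧ (∀ i n, a i n ∈ pInt p) ∧
      ∃ P Q : Polynomial (ZMod p), Q ≠ 0 ∧ natDegree P ≤ B ∧ natDegree Q ≤ B ∧
        (Q : PowerSeries (ZMod p)) * monom (fun i => PowerSeries.mk fun n => (a i n : ZMod p)) m =
          (P : PowerSeries (ZMod p)) *
            monom (fun i => PowerSeries.mk fun n => (a i n : ZMod p)) m') :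
    ∃ P Q : Polynomial ℚ, P ≠ 0 ∧ Q ≠ 0 ∧
      (Q : PowerSeries ℚ) * monom (fun i => PowerSeries.mk (a i)) m =
        (P : PowerSeries ℚ) * monom (fun i => PowerSeries.mk (a i)) m' := by
  have hne : ∀ m : ι → ℕ, monom (fun i => PowerSeries.mk (a i)) m ≠ 0 :=
    monom_ne_zero fun i h0 => by
      have := congrArg (PowerSeries.coeff 0) h0
      simp [ha0] at this
  let v : ℕ → Fin (B + 1) ⊕ Fin (B + 1) → ℚ := fun n => Sum.elim
    (fun j => PowerSeries.coeff n
      (PowerSeries.X ^ (j : ℕ) * monom (fun i => PowerSeries.mk (a i)) m))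
    (fun j => - PowerSeries.coeff n
      (PowerSeries.X ^ (j : ℕ) * monom (fun i => PowerSeries.mk (a i)) m'))
  obtain ⟨x, hx0, hx⟩ := exists_rat_solution v fun N => by
    obtain ⟨p, hp, hN, ha, P, Q, hQ, hPB, hQB, hPQ⟩ := h N
    refine ⟨p, hp, hN, ?_, Sum.elim (fun j => Q.coeff j) (fun j => P.coeff j), ?_, ?_⟩
    · rintro n (j | j)
      · exact (coeff_monom_red ha m j n).1
      · exact neg_mem (coeff_monom_red ha m' j n).1
    · intro h0
      apply hQ
      ext j
      by_cases hj : j < B + 1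
      · exact congrFun h0 (Sum.inl ⟨j, hj⟩)
      · rw [Polynomial.coeff_eq_zero_of_natDegree_lt (by omega), Polynomial.coeff_zero]
    · intro n
      have h1 := congrArg (PowerSeries.coeff n) hPQ
      rw [coeff_coe_mul hQB, coeff_coe_mul hPB] at h1
      rw [Fintype.sum_sum_type]
      simp only [v, Sum.elim_inl, Sum.elim_inr, Rat.cast_neg, (coeff_monom_red ha _ _ n).2, h1]
      simp
  let mkP : (Fin (B + 1) → ℚ) → Polynomial ℚ := fun y =>
    ∑ j, Polynomial.C (y j) * Polynomial.X ^ (j : ℕ)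
  have hdeg : ∀ y, natDegree (mkP y) ≤ B := fun y =>
    Polynomial.natDegree_sum_le_of_forall_le _ _ fun j _ =>
      (Polynomial.natDegree_C_mul_X_pow_le _ _).trans (Nat.le_of_lt_succ j.2)
  have hcoeff : ∀ y (j : Fin (B + 1)), (mkP y).coeff j = y j := fun y j => by
    simp only [mkP, Polynomial.finsetSum_coeff, Polynomial.coeff_C_mul_X_pow]
    rw [Finset.sum_eq_single j (fun k _ hk => by
      rw [if_neg]; exact fun h => hk (Fin.ext h.symm)) (by simp)]
    simp
  set Q := mkP fun j => x (Sum.inl j) with hQ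
  set P := mkP fun j => x (Sum.inr j) with hP
  have heq : (Q : PowerSeries ℚ) * monom (fun i => PowerSeries.mk (a i)) m =
        (P : PowerSeries ℚ) * monom (fun i => PowerSeries.mk (a i)) m' := by
    ext n
    rw [coeff_coe_mul (hdeg _), coeff_coe_mul (hdeg _)]
    simp only [hcoeff]
    have h1 := hx n
    rw [Fintype.sum_sum_type] at h1
    simp only [v, Sum.elim_inl, Sum.elim_inr, neg_mul, Finset.sum_neg_distrib] at h1
    linarith
  -- The linear system only makes the pair `(P, Q)` nonzero; as both monomials are nonzero series,
  -- neither polynomial can vanish alone.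
  have hiff : P = 0 ↔ Q = 0 := by
    constructor
    · intro h0
      rw [h0, Polynomial.coe_zero, zero_mul] at heq
      simpa [hne] using heq
    · intro h0
      rw [h0, Polynomial.coe_zero, zero_mul] at heq
      simpa [hne] using heq.symm
  have hQ0 : Q ≠ 0 := by
    intro h0
    apply hx0
    ext (j | j)
    · rw [← hcoeff (fun j => x (Sum.inl j)) j, ← hQ, h0]; simp
    · rw [← hcoeff (fun j => x (Sum.inr j)) j, ← hP, hiff.2 h0]; simp
  exact ⟨P, Q, fun h => hQ0 (hiff.1 h), hQ0, heq⟩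

end Transfer

/-! ### Descent of relations from `ℂ` to `ℚ` and to `𝔽_p`. -/

section Descent

variable {ι : Type*} [Fintype ι]

/-- Clearing denominators in an algebraic relation over `K(z)`. -/
theorem exists_relation_of_not_algebraicIndependent {K : Type*} [Field K]
    (w : ι → PowerSeries K)
    (h : ¬ AlgebraicIndependent (RatFunc K) fun i => (w i : LaurentSeries K)) :
    ∃ (s : Finset (ι → ℕ)) (c : (ι → ℕ) → Polynomial K), (∃ m ∈ s, c m ≠ 0) ∧
      ∑ m ∈ s, (c m : PowerSeries K) * monom w m = 0 := by
  classical
  rw [algebraicIndependent_iff] at h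
  push Not at h
  obtain ⟨q, hq, hq0⟩ := h
  obtain ⟨b, hb⟩ := IsLocalization.exist_integer_multiples_of_finset
    (nonZeroDivisors (Polynomial K)) (q.support.image fun d => q.coeff d)
  have hb' : ∀ d : ι →₀ ℕ, ∃ c : Polynomial K,
      algebraMap (Polynomial K) (RatFunc K) c = (b : Polynomial K) • q.coeff d := fun d => by
    by_cases hd : d ∈ q.support
    · exact hb _ (Finset.mem_image_of_mem _ hd)
    · exact ⟨0, by rw [MvPolynomial.notMem_support_iff.1 hd]; simp⟩
  choose c hc using hb'
  let e : (ι →₀ ℕ) ≃ (ι → ℕ) := Finsupp.equivFunOnFinite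
  refine ⟨q.support.map e.toEmbedding, fun m => c (e.symm m), ?_, ?_⟩
  · obtain ⟨d, hd⟩ := MvPolynomial.support_nonempty.2 hq0
    refine ⟨e d, Finset.mem_map_of_mem _ hd, fun h0 => ?_⟩
    have h1 := hc d
    simp only [Equiv.symm_apply_apply] at h0
    rw [h0, map_zero, Algebra.smul_def, eq_comm, mul_eq_zero] at h1
    rcases h1 with h1 | h1
    · exact nonZeroDivisors.coe_ne_zero b
        ((map_eq_zero_iff _ (IsFractionRing.injective (Polynomial K) (RatFunc K))).1 h1)
    · exact MvPolynomial.mem_support_iff.1 hd h1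
  · apply HahnSeries.ofPowerSeries_injective (Γ := ℤ) (R := K)
    rw [map_zero, map_sum, Finset.sum_map]
    rw [MvPolynomial.aeval_def, MvPolynomial.eval₂_eq'] at hq
    have h1 := congrArg (algebraMap (RatFunc K) (LaurentSeries K)
      (algebraMap (Polynomial K) (RatFunc K) b) * ·) hq
    simp only [mul_zero, Finset.mul_sum] at h1
    rw [← h1]
    refine Finset.sum_congr rfl fun d _ => ?_
    have h2 := hc d
    rw [Algebra.smul_def] at h2
    rw [map_mul, map_monom, ← mul_assoc]
    simp only [Equiv.toEmbedding_apply, Equiv.symm_apply_apply]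
    congr 1
    refine (RatFunc.coe_coe _).trans ?_
    exact (congrArg (algebraMap (RatFunc K) (LaurentSeries K)) h2).trans (map_mul _ _ _)

/-- Descent of a linear relation from `ℂ` to `ℚ` along a `ℚ`-linear functional. -/
theorem exists_rat_relation {w : ι → PowerSeries ℚ} {s : Finset (ι → ℕ)}
    {c : (ι → ℕ) → Polynomial ℂ} (hc : ∃ m ∈ s, c m ≠ 0)
    (h : ∑ m ∈ s, (c m : PowerSeries ℂ) *
      monom (fun i => PowerSeries.map (algebraMap ℚ ℂ) (w i)) m = 0) :
    ∃ c : (ι → ℕ) → Polynomial ℚ, (∃ m ∈ s, c m ≠ 0) ∧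
      ∑ m ∈ s, (c m : PowerSeries ℚ) * monom w m = 0 := by
  obtain ⟨m0, hm0, hc0⟩ := hc
  obtain ⟨j, hj⟩ : ∃ j, (c m0).coeff j ≠ 0 := by
    by_contra! h0
    exact hc0 (Polynomial.ext h0)
  obtain ⟨L, hL⟩ : ∃ L : Module.Dual ℚ ℂ, L ((c m0).coeff j) ≠ 0 := by
    by_contra! h0
    exact hj ((Module.forall_dual_apply_eq_zero_iff ℚ _).1 h0)
  let c' : (ι → ℕ) → Polynomial ℚ := fun m => ∑ k ∈ Finset.range (natDegree (c m) + 1),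
    Polynomial.C (L ((c m).coeff k)) * Polynomial.X ^ k
  have hc' : ∀ m n, (c' m).coeff n = L ((c m).coeff n) := fun m n => by
    simp only [c', Polynomial.finsetSum_coeff, Polynomial.coeff_C_mul_X_pow, Finset.sum_ite_eq,
      Finset.mem_range]
    split_ifs with hn
    · rfl
    · rw [Polynomial.coeff_eq_zero_of_natDegree_lt (by omega), map_zero]
  refine ⟨c', ⟨m0, hm0, fun h0 => hL ?_⟩, ?_⟩
  · rw [← hc', h0, Polynomial.coeff_zero]
  · ext n
    have h1 := congrArg (fun q => L (PowerSeries.coeff n q)) h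
    simp only [map_zero] at h1
    rw [map_zero, ← h1, map_sum, map_sum, map_sum]
    refine Finset.sum_congr rfl fun m _ => ?_
    rw [← map_monom, PowerSeries.coeff_mul, PowerSeries.coeff_mul, map_sum]
    refine Finset.sum_congr rfl fun x _ => ?_
    rw [Polynomial.coeff_coe, Polynomial.coeff_coe, hc', PowerSeries.coeff_map, mul_comm,
      mul_comm ((c m).coeff _), ← Algebra.smul_def, map_smul, smul_eq_mul]

/-- A linear relation over `ℚ(z)` reduces to a relation modulo every large prime. -/
theorem exists_zmod_relation {a : ι → ℕ → ℚ} {s : Finset (ι → ℕ)}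
    {c : (ι → ℕ) → Polynomial ℚ} (hc : ∃ m ∈ s, c m ≠ 0)
    (h : ∑ m ∈ s, (c m : PowerSeries ℚ) * monom (fun i => PowerSeries.mk (a i)) m = 0) :
    ∃ N : ℕ, ∀ (p : ℕ) [Fact p.Prime], N < p → (∀ i n, a i n ∈ pInt p) →
      ∃ c : (ι → ℕ) → Polynomial (ZMod p), (∃ m ∈ s, c m ≠ 0) ∧
      ∑ m ∈ s, (c m : PowerSeries (ZMod p)) *
        monom (fun i => PowerSeries.mk fun n => (a i n : ZMod p)) m = 0 := by
  classical
  obtain ⟨m0, hm0, hc0⟩ := hc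
  obtain ⟨j, hj⟩ : ∃ j, (c m0).coeff j ≠ 0 := by
    by_contra! h0
    exact hc0 (Polynomial.ext h0)
  obtain ⟨N, hN⟩ := exists_forall_mem_pInt (s.biUnion fun m => (c m).coeffs)
  -- Exceeding the numerator of one nonzero coefficient keeps the reduced relation nontrivial.
  refine ⟨max N ((c m0).coeff j).num.natAbs, fun p _ hp ha => ?_⟩
  have hcm : ∀ m ∈ s, (↑(c m).coeffs : Set ℚ) ⊆ pInt p := fun m hm q hq =>
    hN p ((le_max_left _ _).trans_lt hp) q (Finset.mem_biUnion.2 ⟨m, hm, hq⟩)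
  let C : (ι → ℕ) → Polynomial (pInt p) := fun m =>
    if hm : m ∈ s then (c m).toSubring (pInt p) (hcm m hm) else 0
  have hC : ∀ m ∈ s, ∀ n, (((C m).coeff n : pInt p) : ℚ) = (c m).coeff n := fun m hm n => by
    simp only [C, dif_pos hm, Polynomial.coeff_toSubring]
  have hrel : ∑ m ∈ s, (C m : PowerSeries (pInt p)) * monom (fun i => intSeries p (ha i)) m = 0 := by
    apply PowerSeries.map_injective (pInt p).subtype Subtype.val_injective
    rw [map_sum, map_zero, ← h]
    refine Finset.sum_congr rfl fun m hm => ?_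
    rw [map_mul, map_monom]
    simp only [map_subtype_intSeries]
    congr 1
    ext n
    simp [hC m hm]
  refine ⟨fun m => (C m).map (red p), ⟨m0, hm0, fun h0 => ?_⟩, ?_⟩
  · have h1 := congrArg (fun q => Polynomial.coeff q j) h0
    simp only [Polynomial.coeff_map, Polynomial.coeff_zero] at h1
    change (((C m0).coeff j : ℚ) : ZMod p) = 0 at h1
    rw [hC m0 hm0, Rat.cast_def, div_eq_zero_iff] at h1
    have hmem : (c m0).coeff j ∈ pInt p := by
      rw [← hC m0 hm0]; exact SetLike.coe_mem _
    rcases h1 with h1 | h1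
    · rw [ZMod.intCast_zmod_eq_zero_iff_dvd, Int.natCast_dvd] at h1
      refine not_dvd_of_lt ?_ ((le_max_right _ _).trans_lt hp) h1
      simpa [Int.natAbs_pos] using hj
    · exact den_cast_ne_zero hmem h1
  · have h1 := congrArg (PowerSeries.map (red p)) hrel
    rw [map_sum, map_zero] at h1
    rw [← h1]
    refine Finset.sum_congr rfl fun m _ => ?_
    rw [map_mul, map_monom]
    simp only [map_red_intSeries]
    congr 1
    ext n
    simp

/-- Algebraically dependent series with the Lucas property at infinitely many primes satisfy a
multiplicative relation. -/
theorem exists_multiplicative_relation {a : ι → ℕ → ℚ} (ha0 : ∀ i, a i 0 = 1)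
    (hL : ∀ N : ℕ, ∃ p : ℕ, ∃ _ : Fact p.Prime, N < p ∧ ∀ i, IsLucas p (a i))
    (h : ¬ AlgebraicIndependent (RatFunc ℂ) fun i =>
      (PowerSeries.map (algebraMap ℚ ℂ) (PowerSeries.mk (a i)) : LaurentSeries ℂ)) :
    ∃ m m' : ι → ℕ, m ≠ m' ∧ ∃ P Q : Polynomial ℚ, P ≠ 0 ∧ Q ≠ 0 ∧
      (Q : PowerSeries ℚ) * monom (fun i => PowerSeries.mk (a i)) m =
        (P : PowerSeries ℚ) * monom (fun i => PowerSeries.mk (a i)) m' := by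
  classical
  obtain ⟨s, c, hc, hrel⟩ := exists_relation_of_not_algebraicIndependent _ h
  obtain ⟨c, hc, hrel⟩ := exists_rat_relation hc hrel
  obtain ⟨N₀, hN₀⟩ := exists_zmod_relation hc hrel
  let D := ∑ m ∈ s, ∑ i, m i
  have hD : ∀ m ∈ s, ∀ i, m i ≤ D := fun m hm i =>
    (Finset.single_le_sum (f := m) (fun _ _ => Nat.zero_le _) (Finset.mem_univ i)).trans
      (Finset.single_le_sum (f := fun m : ι → ℕ => ∑ i, m i) (fun _ _ => Nat.zero_le _) hm)
  let B := Fintype.card ι * D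
  let good : (ι → ℕ) × (ι → ℕ) → ℕ → Prop := fun x p => ∃ _ : Fact p.Prime,
    (∀ i n, a i n ∈ pInt p) ∧ ∃ P Q : Polynomial (ZMod p), Q ≠ 0 ∧ natDegree P ≤ B ∧
      natDegree Q ≤ B ∧
        (Q : PowerSeries (ZMod p)) * monom (fun i => PowerSeries.mk fun n => (a i n : ZMod p)) x.1 =
          (P : PowerSeries (ZMod p)) *
            monom (fun i => PowerSeries.mk fun n => (a i n : ZMod p)) x.2
  have key : ∀ N, ∃ p, N < p ∧ ∃ x ∈ s ×ˢ s, x.1 ≠ x.2 ∧ good x p := by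
    intro N
    obtain ⟨p, hp, hNp, hLp⟩ := hL (max N N₀)
    obtain ⟨c, hc, hrel⟩ := hN₀ p ((le_max_right _ _).trans_lt hNp) fun i => (hLp i).mem
    have hA : ∀ i, natDegree (PowerSeries.trunc p
        (PowerSeries.mk fun n => (a i n : ZMod p))) ≤ p - 1 := fun i =>
      Nat.le_sub_one_of_lt (by
        have h1 := PowerSeries.natDegree_trunc_lt (PowerSeries.mk fun n => (a i n : ZMod p)) (p - 1)
        rwa [Nat.sub_add_cancel hp.out.one_lt.le] at h1)
    obtain ⟨m, hm, m', hm', hne, P, Q, -, hQ, hPB, hQB, hPQ⟩ := exists_ratio_of_relation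
      (fun i h0 => by
        have := congrArg (PowerSeries.coeff 0) h0
        simp [ha0] at this) hA (fun i => (hLp i).eq_trunc_mul_pow) s hD c hc hrel
    exact ⟨p, (le_max_left _ _).trans_lt hNp, (m, m'), Finset.mem_product.2 ⟨hm, hm'⟩, hne, hp,
      fun i => (hLp i).mem, P, Q, hQ, hPB, hQB, hPQ⟩
  let T : Finset ((ι → ℕ) × (ι → ℕ)) := (s ×ˢ s).filter fun x => x.1 ≠ x.2
  -- Pigeonhole: there are finitely many pairs of monomials, and the height bound `B` is the same
  -- for every prime.
  obtain ⟨x, hx, hgood⟩ : ∃ x ∈ T, ∀ N, ∃ p, N < p ∧ good x p := by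
    by_contra! hcon
    choose! M hM using hcon
    obtain ⟨p, hp, x, hx, hne, hg⟩ := key (∑ x ∈ T, M x)
    have hx' : x ∈ T := Finset.mem_filter.2 ⟨hx, hne⟩
    exact hM x hx' p ((Finset.single_le_sum (f := M) (fun _ _ => Nat.zero_le _) hx').trans_lt hp) hg
  refine ⟨x.1, x.2, (Finset.mem_filter.1 hx).2, exists_rat_ratio ha0 x.1 x.2 B fun N => ?_⟩
  obtain ⟨p, hN, hp, hg⟩ := hgood N
  exact ⟨p, hp, hN, hg⟩

end Descent

open Filter Topology

/-! ### Values of real power series. -/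

section Evaluation

/-- The power series `w` converges absolutely at `x`, with sum `y`. -/
def HasEval (w : PowerSeries ℝ) (x y : ℝ) : Prop :=
  (Summable fun n => ‖PowerSeries.coeff n w * x ^ n‖) ∧
    ∑' n, PowerSeries.coeff n w * x ^ n = y

theorem HasEval.mul {w w' : PowerSeries ℝ} {x y y' : ℝ} (h : HasEval w x y)
    (h' : HasEval w' x y') : HasEval (w * w') x (y * y') := by
  have e : ∀ n, ∑ kl ∈ Finset.HasAntidiagonal.antidiagonal n, PowerSeries.coeff kl.1 w * x ^ kl.1 *
      (PowerSeries.coeff kl.2 w' * x ^ kl.2) = PowerSeries.coeff n (w * w') * x ^ n := fun n => by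
    rw [PowerSeries.coeff_mul, Finset.sum_mul]
    refine Finset.sum_congr rfl fun kl hkl => ?_
    rw [← Finset.HasAntidiagonal.mem_antidiagonal.1 hkl, pow_add]
    ring
  have h1 := summable_norm_sum_mul_antidiagonal_of_summable_norm h.1 h'.1
  have h2 := tsum_mul_tsum_eq_tsum_sum_antidiagonal_of_summable_norm h.1 h'.1
  simp only [e] at h1 h2
  exact ⟨h1, by rw [← h2, h.2, h'.2]⟩

theorem HasEval.coe (P : Polynomial ℝ) (x : ℝ) : HasEval (P : PowerSeries ℝ) x (P.eval x) := by
  have h0 : ∀ n ∉ Finset.range (P.natDegree + 1),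
      PowerSeries.coeff n (P : PowerSeries ℝ) * x ^ n = 0 := fun n hn => by
    rw [Polynomial.coeff_coe, Polynomial.coeff_eq_zero_of_natDegree_lt (by simpa using hn),
      zero_mul]
  refine ⟨summable_of_ne_finset_zero (s := Finset.range (P.natDegree + 1)) fun n hn => by
    rw [h0 n hn, norm_zero], ?_⟩
  rw [tsum_eq_sum h0, Polynomial.eval_eq_sum_range]
  simp

theorem HasEval.pow {w : PowerSeries ℝ} {x y : ℝ} (h : HasEval w x y) (n : ℕ) :
    HasEval (w ^ n) x (y ^ n) := by
  induction n with
  | zero => simpa using HasEval.coe 1 x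
  | succ n ih => rw [pow_succ, pow_succ]; exact ih.mul h

theorem HasEval.eq {w : PowerSeries ℝ} {x y y' : ℝ} (h : HasEval w x y) (h' : HasEval w x y') :
    y = y' := h.2.symm.trans h'.2

theorem hasEval_mk {c : ℕ → ℝ} {x : ℝ} (h : Summable fun n => ‖c n * x ^ n‖) :
    HasEval (PowerSeries.mk c) x (∑' n, c n * x ^ n) := by
  simpa [HasEval] using h

theorem contDiffAt_tsum {c : ℕ → ℝ} {r x : ℝ} (hr : 0 < r) (h : Summable fun n => ‖c n * r ^ n‖)
    (hx : |x| < r) : ContDiffAt ℝ 1 (fun x => ∑' n, c n * x ^ n) x := by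
  let q := FormalMultilinearSeries.ofScalars ℝ c
  lift r to NNReal using hr.le
  have hq : (r : ENNReal) ≤ q.radius := by
    refine q.le_radius_of_summable_norm ?_
    simpa [q, FormalMultilinearSeries.ofScalars_norm] using h
  have h0 : 0 < q.radius := lt_of_lt_of_le (by exact_mod_cast hr) hq
  have h1 := q.hasFPowerSeriesOnBall h0
  have h2 : x ∈ Metric.eball (0 : ℝ) q.radius := by
    refine Metric.eball_subset_eball hq ?_
    simp only [Metric.mem_eball, edist_dist, dist_zero_right, Real.norm_eq_abs]
    rw [ENNReal.ofReal_lt_coe_iff (abs_nonneg x)]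
    exact hx
  have h3 := (h1.analyticAt_of_mem h2).contDiffAt (n := 1)
  refine h3.congr_of_eventuallyEq (Eventually.of_forall fun y => ?_)
  have := FormalMultilinearSeries.ofScalars_sum_eq (E := ℝ) c y
  simp only [smul_eq_mul] at this
  exact this.symm

end Evaluation

/-! ### Singular behaviour at the radius of convergence. -/

section Asymptotics

/-- Cancelling the common power of `x - ρ` removes the indeterminate form `0/0` at `ρ`. -/
theorem exists_not_both_root {P Q : Polynomial ℝ} (hP : P ≠ 0) (hQ : Q ≠ 0) (ρ : ℝ) :
    ∃ P' Q' : Polynomial ℝ, (P'.eval ρ ≠ 0 ∨ Q'.eval ρ ≠ 0) ∧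
      ∀ x y, x ≠ ρ → Q.eval x * y = P.eval x → Q'.eval x * y = P'.eval x := by
  obtain ⟨P₁, hP₁, hPn⟩ := Polynomial.exists_eq_pow_rootMultiplicity_mul_and_not_dvd P hP ρ
  obtain ⟨Q₁, hQ₁, hQn⟩ := Polynomial.exists_eq_pow_rootMultiplicity_mul_and_not_dvd Q hQ ρ
  rw [Polynomial.dvd_iff_isRoot, Polynomial.IsRoot] at hPn hQn
  generalize P.rootMultiplicity ρ = k at hP₁
  generalize Q.rootMultiplicity ρ = l at hQ₁
  subst hP₁ hQ₁
  rcases le_total k l with h | h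
  · obtain ⟨d, rfl⟩ := Nat.exists_eq_add_of_le h
    refine ⟨P₁, (Polynomial.X - Polynomial.C ρ) ^ d * Q₁, Or.inl hPn, fun x y hx hxy => ?_⟩
    have hx' : (x - ρ) ^ k ≠ 0 := pow_ne_zero _ (sub_ne_zero.2 hx)
    simp only [Polynomial.eval_mul, Polynomial.eval_pow, Polynomial.eval_sub, Polynomial.eval_X,
      Polynomial.eval_C, pow_add] at hxy ⊢
    exact mul_left_cancel₀ hx' (by linear_combination hxy)
  · obtain ⟨d, rfl⟩ := Nat.exists_eq_add_of_le h
    refine ⟨(Polynomial.X - Polynomial.C ρ) ^ d * P₁, Q₁, Or.inr hQn, fun x y hx hxy => ?_⟩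
    have hx' : (x - ρ) ^ l ≠ 0 := pow_ne_zero _ (sub_ne_zero.2 hx)
    simp only [Polynomial.eval_mul, Polynomial.eval_pow, Polynomial.eval_sub, Polynomial.eval_X,
      Polynomial.eval_C, pow_add] at hxy ⊢
    exact mul_left_cancel₀ hx' (by linear_combination hxy)

theorem tendsto_eval_left (P : Polynomial ℝ) (ρ : ℝ) :
    Tendsto (fun x => P.eval x) (𝓝[<] ρ) (𝓝 (P.eval ρ)) :=
  (P.continuous.tendsto ρ).mono_left nhdsWithin_le_nhds

/-- A function going to infinity slower than every power cannot be a root of a rational function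
up to a bounded factor. -/
theorem false_of_tendsto_atTop {F G : ℝ → ℝ} {ρ : ℝ} {n : ℕ} (hn : n ≠ 0)
    (hF : Tendsto F (𝓝[<] ρ) atTop)
    (hF' : Tendsto (fun x => (ρ - x) * F x ^ n) (𝓝[<] ρ) (𝓝 0))
    {m M : ℝ} (hm : 0 < m) (hG : ∀ᶠ x in 𝓝[<] ρ, m ≤ |G x| ∧ |G x| ≤ M)
    {P Q : Polynomial ℝ} (hP : P ≠ 0) (hQ : Q ≠ 0)
    (h : ∀ᶠ x in 𝓝[<] ρ, Q.eval x * (F x ^ n * G x) = P.eval x) : False := by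
  obtain ⟨P', Q', hPQ, hrel⟩ := exists_not_both_root hP hQ ρ
  have hne : ∀ᶠ x in 𝓝[<] ρ, x ≠ ρ := by
    filter_upwards [self_mem_nhdsWithin] with x hx using (Set.mem_Iio.1 hx).ne
  have h' : ∀ᶠ x in 𝓝[<] ρ, Q'.eval x * (F x ^ n * G x) = P'.eval x := by
    filter_upwards [h, hne] with x hx hxρ using hrel _ _ hxρ hx
  by_cases hQ0 : Q'.eval ρ = 0
  · have hP0 : P'.eval ρ ≠ 0 := hPQ.resolve_right fun h => h hQ0
    obtain ⟨R, hR⟩ := Polynomial.dvd_iff_isRoot.2 hQ0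
    have h1 : Tendsto (fun x => (ρ - x) * F x ^ n * R.eval x) (𝓝[<] ρ) (𝓝 0) := by
      simpa using hF'.mul (tendsto_eval_left R ρ)
    have h2 : Tendsto (fun x => (ρ - x) * F x ^ n * R.eval x * G x) (𝓝[<] ρ) (𝓝 0) :=
      h1.zero_mul_isBoundedUnder_le
        ⟨M, eventually_map.2 (hG.mono fun x hx => by simpa using hx.2)⟩
    have h3 : Tendsto (fun x => P'.eval x) (𝓝[<] ρ) (𝓝 0) := by
      refine Tendsto.congr' ?_ (by simpa using h2.neg)
      filter_upwards [h'] with x hx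
      rw [← hx, hR]
      simp only [Polynomial.eval_mul, Polynomial.eval_sub, Polynomial.eval_X, Polynomial.eval_C]
      ring
    exact hP0 (tendsto_nhds_unique (tendsto_eval_left P' ρ) h3)
  · have h1 : Tendsto (fun x => |P'.eval x|) (𝓝[<] ρ) (𝓝 |P'.eval ρ|) :=
      (tendsto_eval_left P' ρ).abs
    have h2 : Tendsto (fun x => |Q'.eval x| * (F x ^ n * m)) (𝓝[<] ρ) atTop :=
      ((tendsto_eval_left Q' ρ).abs).pos_mul_atTop (abs_pos.2 hQ0)
        (((tendsto_pow_atTop hn).comp hF).atTop_mul_const hm)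
    have h3 : Tendsto (fun x => |P'.eval x|) (𝓝[<] ρ) atTop := by
      refine tendsto_atTop_mono' _ ?_ h2
      filter_upwards [h', hG, hF.eventually_ge_atTop 0] with x hx hGx hFx
      rw [← hx, abs_mul, abs_mul, abs_of_nonneg (pow_nonneg hFx n)]
      gcongr
      exact hGx.1
    exact not_tendsto_nhds_of_tendsto_atTop h3 _ h1

/-- Nonnegative coefficients `c` with `c n * ρ ^ n` of order at most `1 / n`. -/
structure Tame (c : ℕ → ℝ) (ρ : ℝ) : Prop where
  pos : 0 < ρ
  zero : c 0 = 1
  nonneg : ∀ n, 0 ≤ c n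
  upper : ∃ K, ∀ n : ℕ, c n * ρ ^ n ≤ K / (n + 1)

namespace Tame

variable {c : ℕ → ℝ} {ρ : ℝ} (H : Tame c ρ)

include H

theorem summable {x : ℝ} (hx0 : 0 ≤ x) (hx : x < ρ) : Summable fun n => c n * x ^ n := by
  obtain ⟨K, hK⟩ := H.upper
  have hρ := H.pos
  have hy : x / ρ < 1 := (div_lt_one hρ).2 hx
  have hK0 : 0 ≤ K := by
    have h1 := hK 0
    have h2 := H.nonneg 0
    simp only [pow_zero, mul_one, Nat.cast_zero, zero_add, div_one] at h1
    linarith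
  refine Summable.of_nonneg_of_le (fun n => mul_nonneg (H.nonneg n) (pow_nonneg hx0 n)) (fun n => ?_)
    ((summable_geometric_of_lt_one (by positivity) hy).mul_left K)
  have h1 : c n * x ^ n = c n * ρ ^ n * (x / ρ) ^ n := by
    rw [div_pow]; field_simp
  rw [h1]
  gcongr
  exact (hK n).trans (div_le_self hK0 (by linarith [Nat.cast_nonneg (α := ℝ) n]))

theorem summable_norm {x : ℝ} (hx0 : 0 ≤ x) (hx : x < ρ) : Summable fun n => ‖c n * x ^ n‖ :=
  (H.summable hx0 hx).norm

theorem sum_le {x : ℝ} (hx0 : 0 ≤ x) (hx : x < ρ) (s : Finset ℕ) :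
    ∑ n ∈ s, c n * x ^ n ≤ ∑' n, c n * x ^ n :=
  (H.summable hx0 hx).sum_le_tsum s fun n _ => mul_nonneg (H.nonneg n) (pow_nonneg hx0 n)

theorem one_le {x : ℝ} (hx0 : 0 ≤ x) (hx : x < ρ) : 1 ≤ ∑' n, c n * x ^ n := by
  simpa [H.zero] using H.sum_le hx0 hx {0}

theorem mono {x y : ℝ} (hx0 : 0 ≤ x) (hxy : x ≤ y) (hy : y < ρ) :
    ∑' n, c n * x ^ n ≤ ∑' n, c n * y ^ n :=
  (H.summable hx0 (hxy.trans_lt hy)).tsum_le_tsum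
    (fun n => mul_le_mul_of_nonneg_left (pow_le_pow_left₀ hx0 hxy n) (H.nonneg n))
    (H.summable (hx0.trans hxy) hy)

theorem eventually_left : ∀ᶠ x in 𝓝[<] ρ, 0 < x ∧ x < ρ := by
  filter_upwards [Ioo_mem_nhdsLT H.pos] with x hx using hx

/-- Scaled coefficients of order `1/n` give at most logarithmic growth, which is slower than any
pole. -/
theorem tendsto_mul_pow (n : ℕ) :
    Tendsto (fun x => (ρ - x) * (∑' k, c k * x ^ k) ^ n) (𝓝[<] ρ) (𝓝 0) := by
  obtain ⟨K, hK⟩ := H.upper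
  have hρ := H.pos
  have hlog : ∀ᶠ x in 𝓝[<] ρ, ∑' k, c k * x ^ k ≤ 2 * K * Real.log ((1 - x / ρ)⁻¹) := by
    filter_upwards [Ioo_mem_nhdsLT (show ρ / 2 < ρ by linarith)] with x hx
    have hx0 : 0 < x := by linarith [hx.1]
    have hy0 : 0 < x / ρ := by positivity
    have hy : x / ρ < 1 := (div_lt_one hρ).2 hx.2
    -- The logarithm series carries `(x / ρ) ^ (k + 1)`; the factor 2 in the bound pays for this
    -- shift of exponent.
    have hy2 : 1 / 2 ≤ x / ρ := by rw [le_div_iff₀ hρ]; linarith [hx.1]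
    have hK0 : 0 ≤ K := by
      have h1 := hK 0
      have h2 := H.nonneg 0
      simp only [pow_zero, mul_one, Nat.cast_zero, zero_add, div_one] at h1
      linarith
    have hs := Real.hasSum_pow_div_log_of_abs_lt_one (x := x / ρ) (by rwa [abs_of_pos hy0])
    rw [Real.log_inv]
    refine hasSum_le (fun k => ?_) (H.summable hx0.le hx.2).hasSum (hs.mul_left (2 * K))
    have h1 : c k * x ^ k = c k * ρ ^ k * (x / ρ) ^ k := by
      rw [div_pow]; field_simp
    rw [h1]
    calc c k * ρ ^ k * (x / ρ) ^ k ≤ K / (k + 1) * (x / ρ) ^ k := by gcongr; exact hK k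
      _ ≤ K / (k + 1) * (x / ρ) ^ k * (2 * (x / ρ)) :=
        le_mul_of_one_le_right (by positivity) (by linarith)
      _ = 2 * K * ((x / ρ) ^ (k + 1) / (k + 1)) := by ring
  have hinv : Tendsto (fun x => (1 - x / ρ)⁻¹) (𝓝[<] ρ) atTop := by
    refine tendsto_inv_nhdsGT_zero.comp (tendsto_nhdsWithin_iff.2 ⟨?_, ?_⟩)
    · have : Tendsto (fun x => 1 - x / ρ) (𝓝 ρ) (𝓝 (1 - ρ / ρ)) :=
        (Continuous.tendsto (by fun_prop) ρ)
      rw [div_self hρ.ne', sub_self] at this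
      exact this.mono_left nhdsWithin_le_nhds
    · filter_upwards [self_mem_nhdsWithin] with x hx
      have : x / ρ < 1 := (div_lt_one hρ).2 hx
      simpa using this
  have h1 := (Real.tendsto_pow_log_div_mul_add_atTop 1 0 n one_ne_zero).comp hinv
  have h2 : Tendsto (fun x => ρ * (2 * K) ^ n *
      ((fun x => Real.log x ^ n / (1 * x + 0)) ∘ fun x => (1 - x / ρ)⁻¹) x) (𝓝[<] ρ) (𝓝 0) := by
    simpa using h1.const_mul (ρ * (2 * K) ^ n)
  refine squeeze_zero' ?_ ?_ h2
  · filter_upwards [H.eventually_left] with x hx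
    have := H.one_le hx.1.le hx.2
    exact mul_nonneg (by linarith [hx.2]) (by positivity)
  · filter_upwards [H.eventually_left, hlog] with x hx hl
    have h3 := H.one_le hx.1.le hx.2
    have h4 : (ρ - x) = ρ * (1 - x / ρ) := by field_simp
    have h5 : 0 ≤ ρ - x := by linarith [hx.2]
    calc (ρ - x) * (∑' k, c k * x ^ k) ^ n
        ≤ (ρ - x) * (2 * K * Real.log ((1 - x / ρ)⁻¹)) ^ n := by gcongr
      _ = _ := by
        simp only [Function.comp, one_mul, add_zero]
        rw [mul_pow, div_inv_eq_mul, h4]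
        ring

theorem tendsto_atTop_of_not_bounded (hb : ¬ ∃ M, ∀ x, 0 ≤ x → x < ρ → ∑' k, c k * x ^ k ≤ M) :
    Tendsto (fun x => ∑' k, c k * x ^ k) (𝓝[<] ρ) atTop := by
  rw [tendsto_atTop]
  intro M
  push Not at hb
  obtain ⟨y, hy0, hy, hM⟩ := hb M
  filter_upwards [Ioo_mem_nhdsLT hy] with x hx
  exact hM.le.trans (H.mono hy0 hx.1.le hx.2)

theorem sum_le_of_bounded {M : ℝ} (hb : ∀ x, 0 ≤ x → x < ρ → ∑' k, c k * x ^ k ≤ M)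
    (s : Finset ℕ) : ∑ n ∈ s, c n * ρ ^ n ≤ M := by
  have h1 : Tendsto (fun x => ∑ n ∈ s, c n * x ^ n) (𝓝[<] ρ) (𝓝 (∑ n ∈ s, c n * ρ ^ n)) :=
    (Continuous.tendsto (by fun_prop) ρ).mono_left nhdsWithin_le_nhds
  refine le_of_tendsto h1 ?_
  filter_upwards [H.eventually_left] with x hx
  exact (H.sum_le hx.1.le hx.2 s).trans (hb x hx.1.le hx.2)

theorem tendsto_atTop (hs : ¬ Summable fun n => c n * ρ ^ n) :
    Tendsto (fun x => ∑' k, c k * x ^ k) (𝓝[<] ρ) Filter.atTop := by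
  refine H.tendsto_atTop_of_not_bounded ?_
  rintro ⟨M, hM⟩
  exact hs (summable_of_sum_le (fun n => mul_nonneg (H.nonneg n) (pow_nonneg H.pos.le n))
    (H.sum_le_of_bounded hM))

/-- A Lipschitz bound would bound the partial sums of the derivative series at `ρ`, whose terms
dominate a multiple of `1/k`; the harmonic series would converge. -/
theorem not_lipschitz {δ : ℝ} (hδ : 0 < δ) (hlo : ∀ n : ℕ, 1 ≤ n → δ / n ^ 2 ≤ c n * ρ ^ n)
    {L r : ℝ} (hr0 : 0 ≤ r) (hr : r < ρ)
    (hL : ∀ x y, r < x → x < y → y < ρ →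
      ∑' k, c k * y ^ k - ∑' k, c k * x ^ k ≤ L * (y - x)) : False := by
  have hρ := H.pos
  have h1 : ∀ x, r < x → x < ρ → ∀ N : ℕ, ∑ k ∈ Finset.range N, c k * (k * x ^ (k - 1)) ≤ L := by
    intro x hrx hx N
    have hx0 : 0 < x := hr0.trans_lt hrx
    have hy : (x + ρ) / 2 < ρ := by linarith
    set y := (x + ρ) / 2
    have hxy : x < y := by simp only [y]; linarith
    have h2 : ∑ k ∈ Finset.range N, c k * (k * x ^ (k - 1)) * (y - x) ≤ L * (y - x) := by
      refine le_trans ?_ (hL x y hrx hxy hy)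
      rw [← (H.summable (hx0.trans hxy).le hy).tsum_sub (H.summable hx0.le hx)]
      have hpos : ∀ k, c k * (k * x ^ (k - 1)) * (y - x) ≤ c k * y ^ k - c k * x ^ k := by
        intro k
        rw [← mul_sub, mul_assoc]
        refine mul_le_mul_of_nonneg_left ?_ (H.nonneg k)
        rw [← Commute.geom_sum₂_mul (Commute.all y x)]
        refine mul_le_mul_of_nonneg_right ?_ (by linarith)
        have h3 : ∀ i ∈ Finset.range k, x ^ (k - 1) ≤ y ^ i * x ^ (k - 1 - i) := by
          intro i hi
          have h4 : k - 1 = i + (k - 1 - i) := by have := Finset.mem_range.1 hi; omega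
          conv_lhs => rw [h4, pow_add]
          gcongr
        have := Finset.card_nsmul_le_sum _ _ _ h3
        simpa using this
      refine (Finset.sum_le_sum fun k _ => hpos k).trans ?_
      refine ((H.summable (hx0.trans hxy).le hy).sub (H.summable hx0.le hx)).sum_le_tsum _
        fun k _ => ?_
      refine le_trans ?_ (hpos k)
      have := H.nonneg k
      have : 0 < y - x := by linarith
      positivity
    rw [← Finset.sum_mul] at h2
    exact le_of_mul_le_mul_right h2 (by linarith)
  have h2 : ∀ N : ℕ, ∑ k ∈ Finset.range N, c k * (k * ρ ^ (k - 1)) ≤ L := by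
    intro N
    have h3 : Tendsto (fun x => ∑ k ∈ Finset.range N, c k * (k * x ^ (k - 1))) (𝓝[<] ρ)
        (𝓝 (∑ k ∈ Finset.range N, c k * (k * ρ ^ (k - 1)))) :=
      (Continuous.tendsto (by fun_prop) ρ).mono_left nhdsWithin_le_nhds
    refine le_of_tendsto h3 ?_
    filter_upwards [Ioo_mem_nhdsLT hr] with x hx using h1 x hx.1 hx.2 N
  have h3 : Summable fun k : ℕ => c k * (k * ρ ^ (k - 1)) :=
    summable_of_sum_range_le (fun k => mul_nonneg (H.nonneg k) (by positivity)) h2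
  refine Real.not_summable_one_div_natCast ?_
  refine Summable.of_nonneg_of_le (fun k => by positivity) (fun k => ?_) (h3.mul_left (ρ / δ))
  rcases Nat.eq_zero_or_pos k with rfl | hk
  · simp
  · have h4 := hlo k hk
    have hk' : (0 : ℝ) < k := by exact_mod_cast hk
    have h5 : ρ ^ k = ρ * ρ ^ (k - 1) := by
      rw [← pow_succ', Nat.sub_add_cancel hk]
    rw [div_le_iff₀ (by positivity), h5] at h4
    rw [div_le_iff₀ hk', div_mul_eq_mul_div, div_mul_eq_mul_div, le_div_iff₀ hδ]
    linarith

/-- A series with coefficients between `1 / n ^ 2` and `1 / n` (after scaling) has a genuine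
singularity at `ρ`: no power of it is rational up to a factor smooth and nonzero at `ρ`. -/
theorem false_of_contDiffAt {δ : ℝ} (hδ : 0 < δ)
    (hlo : ∀ n : ℕ, 1 ≤ n → δ / n ^ 2 ≤ c n * ρ ^ n) {n : ℕ} (hn : n ≠ 0) {G : ℝ → ℝ}
    (hG : ContDiffAt ℝ 1 G ρ) (hG0 : G ρ ≠ 0) {P Q : Polynomial ℝ} (hP : P ≠ 0) (hQ : Q ≠ 0)
    (h : ∀ x, 0 ≤ x → x < ρ → Q.eval x * ((∑' k, c k * x ^ k) ^ n * G x) = P.eval x) :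
    False := by
  have hGt : Tendsto G (𝓝[<] ρ) (𝓝 (G ρ)) := hG.continuousAt.tendsto.mono_left nhdsWithin_le_nhds
  have hev : ∀ᶠ x in 𝓝[<] ρ, Q.eval x * ((∑' k, c k * x ^ k) ^ n * G x) = P.eval x := by
    filter_upwards [H.eventually_left] with x hx using h x hx.1.le hx.2
  by_cases hb : ∃ M, ∀ x, 0 ≤ x → x < ρ → ∑' k, c k * x ^ k ≤ M
  · obtain ⟨M, hM⟩ := hb
    obtain ⟨P', Q', hPQ, hrel⟩ := exists_not_both_root hP hQ ρ
    have h' : ∀ x, 0 ≤ x → x < ρ → Q'.eval x * ((∑' k, c k * x ^ k) ^ n * G x) = P'.eval x :=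
      fun x hx0 hx => hrel _ _ hx.ne (h x hx0 hx)
    by_cases hQ0 : Q'.eval ρ = 0
    · have hP0 : P'.eval ρ ≠ 0 := hPQ.resolve_right fun h => h hQ0
      have h1 : Tendsto (fun x => Q'.eval x * G x) (𝓝[<] ρ) (𝓝 0) := by
        have := (tendsto_eval_left Q' ρ).mul hGt
        rwa [hQ0, zero_mul] at this
      have h2 : Tendsto (fun x => Q'.eval x * G x * (∑' k, c k * x ^ k) ^ n) (𝓝[<] ρ) (𝓝 0) := by
        refine h1.zero_mul_isBoundedUnder_le ⟨M ^ n, eventually_map.2 ?_⟩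
        filter_upwards [H.eventually_left] with x hx
        have h3 := H.one_le hx.1.le hx.2
        have h4 := hM x hx.1.le hx.2
        simp only [Function.comp, norm_pow, Real.norm_eq_abs]
        rw [abs_of_nonneg (by linarith)]
        exact pow_le_pow_left₀ (by linarith) h4 n
      refine hP0 (tendsto_nhds_unique (tendsto_eval_left P' ρ) (h2.congr' ?_))
      filter_upwards [H.eventually_left] with x hx
      rw [← h' x hx.1.le hx.2]
      ring
    · have hpol : ∀ R : Polynomial ℝ, ContDiffAt ℝ 1 (fun x => R.eval x) ρ := fun R => by
        simpa using (Polynomial.contDiff_aeval (𝕜 := ℝ) R 1).contDiffAt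
      -- On the left of `ρ` this is the `n`-th power of the sum. It is Lipschitz there, and since
      -- the sum is at least 1 the sum itself inherits the bound.
      have hR : ContDiffAt ℝ 1 (fun x => P'.eval x / (Q'.eval x * G x)) ρ :=
        (hpol P').div ((hpol Q').mul hG) (mul_ne_zero hQ0 hG0)
      obtain ⟨K, t, ht, hK⟩ := hR.exists_lipschitzOnWith
      have hne : ∀ᶠ x in 𝓝 ρ, x ∈ t ∧ Q'.eval x * G x ≠ 0 :=
        (eventually_mem_set.2 ht).and
          ((Q'.continuous.continuousAt.mul hG.continuousAt).eventually_ne (mul_ne_zero hQ0 hG0))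
      obtain ⟨ε, hε, hball⟩ := Metric.eventually_nhds_iff.1 hne
      refine H.not_lipschitz hδ hlo (L := K) (r := max 0 (ρ - ε)) (le_max_left _ _)
        (max_lt H.pos (by linarith)) fun x y hrx hxy hy => ?_
      have hx0 : 0 ≤ x := ((le_max_left _ _).trans_lt hrx).le
      have hxε : ρ - ε < x := (le_max_right _ _).trans_lt hrx
      obtain ⟨hxt, hxne⟩ := hball (y := x) (by rw [Real.dist_eq, abs_lt]; constructor <;> linarith)
      obtain ⟨hyt, hyne⟩ := hball (y := y) (by rw [Real.dist_eq, abs_lt]; constructor <;> linarith)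
      have ex : P'.eval x / (Q'.eval x * G x) = (∑' k, c k * x ^ k) ^ n := by
        rw [div_eq_iff hxne, ← h' x hx0 (hxy.trans hy)]; ring
      have ey : P'.eval y / (Q'.eval y * G y) = (∑' k, c k * y ^ k) ^ n := by
        rw [div_eq_iff hyne, ← h' y (hx0.trans hxy.le) hy]; ring
      have h1 := hK.dist_le_mul y hyt x hxt
      simp only [ex, ey] at h1
      rw [Real.dist_eq, Real.dist_eq, abs_of_pos (sub_pos.2 hxy)] at h1
      refine le_trans ?_ ((le_abs_self _).trans h1)
      have hx1 := H.one_le hx0 (hxy.trans hy)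
      have hxy' := H.mono hx0 hxy.le hy
      generalize ∑' k, c k * x ^ k = a at hx1 hxy'
      generalize ∑' k, c k * y ^ k = b at hxy'
      rw [← Commute.geom_sum₂_mul (Commute.all b a)]
      refine le_mul_of_one_le_left (by linarith) ?_
      have h2 : ∀ i ∈ Finset.range n, 1 ≤ b ^ i * a ^ (n - 1 - i) := fun i _ =>
        one_le_mul_of_one_le_of_one_le (one_le_pow₀ (hx1.trans hxy')) (one_le_pow₀ hx1)
      refine le_trans ?_ (Finset.card_nsmul_le_sum _ _ _ h2)
      simpa using Nat.one_le_iff_ne_zero.2 hn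
  · refine false_of_tendsto_atTop hn (H.tendsto_atTop_of_not_bounded hb) (H.tendsto_mul_pow n)
      (m := |G ρ| / 2) (M := 2 * |G ρ|) (by positivity) ?_ hP hQ hev
    have h1 := hGt.abs
    have h2 : 0 < |G ρ| := abs_pos.2 hG0
    filter_upwards [h1.eventually_const_le (show |G ρ| / 2 < |G ρ| by linarith),
      h1.eventually_le_const (show |G ρ| < 2 * |G ρ| by linarith)] with x hx hx'
    exact ⟨hx, hx'⟩

end Tame

end Asymptotics

/-! ### Size of the hypergeometric coefficients. -/

section Bounds

/-- A positive sequence with `t (n + 1) * den n = t n * num n`. -/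
structure Ratio (t num den : ℕ → ℝ) : Prop where
  zero : t 0 = 1
  den_pos : ∀ n, 0 < den n
  num_pos : ∀ n, 0 < num n
  succ : ∀ n, t (n + 1) * den n = t n * num n

namespace Ratio

variable {t num den : ℕ → ℝ} (H : Ratio t num den)

include H

theorem pos (n : ℕ) : 0 < t n := by
  induction n with
  | zero => rw [H.zero]; exact one_pos
  | succ n ih =>
    have h1 := H.succ n
    exact pos_of_mul_pos_left (h1 ▸ mul_pos ih (H.num_pos n)) (H.den_pos n).le

/-- The hypothesis makes `(n + 1) * t n` nonincreasing. -/
theorem upper (h : ∀ n : ℕ, num n * (n + 2) ≤ den n * (n + 1)) (n : ℕ) :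
    t n ≤ 1 / ((n : ℝ) + 1) := by
  induction n with
  | zero => simp [H.zero]
  | succ n ih =>
    have h1 := H.succ n
    have hd := H.den_pos n
    have hn := H.num_pos n
    rw [le_div_iff₀ (by positivity)] at ih ⊢
    push_cast
    have h2 : t (n + 1) * (n + 1 + 1) * den n ≤ 1 * den n := by
      calc t (n + 1) * (n + 1 + 1) * den n = t n * (num n * (n + 2)) := by
            linear_combination ((n : ℝ) + 2) * h1
        _ ≤ t n * (den n * (n + 1)) := mul_le_mul_of_nonneg_left (h n) (H.pos n).le
        _ = (t n * (n + 1)) * den n := by ring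
        _ ≤ 1 * den n := by gcongr
    exact le_of_mul_le_mul_right h2 hd

/-- The hypothesis makes `n ^ k * t n` nondecreasing. -/
theorem lower (k : ℕ) (h : ∀ n : ℕ, (n : ℝ) ^ k * den n ≤ num n * (n + 1) ^ k) (n : ℕ)
    (hn : 1 ≤ n) : t 1 / (n : ℝ) ^ k ≤ t n := by
  induction n, hn using Nat.le_induction with
  | base => simp
  | succ n hn1 ih =>
    have h1 := H.succ n
    have hd := H.den_pos n
    have hn : (0 : ℝ) < n := by exact_mod_cast hn1
    rw [div_le_iff₀ (by positivity)] at ih ⊢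
    push_cast
    refine ih.trans ?_
    have h2 : t n * n ^ k * den n ≤ t (n + 1) * ((n : ℝ) + 1) ^ k * den n := by
      calc t n * n ^ k * den n = t n * (n ^ k * den n) := by ring
        _ ≤ t n * (num n * (n + 1) ^ k) := mul_le_mul_of_nonneg_left (h n) (H.pos n).le
        _ = t (n + 1) * ((n : ℝ) + 1) ^ k * den n := by
          linear_combination -(((n : ℝ) + 1) ^ k) * h1
    exact le_of_mul_le_mul_right h2 hd

/-- Raabe's test, by telescoping `n * t n`. -/
theorem summable_of_raabe {N : ℕ} (h : ∀ n : ℕ, N ≤ n → den n * (1 / 2) ≤ n * den n - (n + 1) * num n) :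
    Summable t := by
  have h1 : ∀ n, N ≤ n → t n ≤ 2 * (n * t n - (n + 1) * t (n + 1)) := by
    intro n hn
    have h2 := H.succ n
    have h3 := h n hn
    refine le_of_mul_le_mul_right ?_ (H.den_pos n)
    have h4 := mul_le_mul_of_nonneg_left h3 (H.pos n).le
    nlinarith
  have h2 : ∀ n, ∑ k ∈ Finset.range n, t (k + N) ≤ 2 * (N * t N - (n + N : ℕ) * t (n + N)) := by
    intro n
    induction n with
    | zero => simp
    | succ n ih =>
      rw [Finset.sum_range_succ]
      have h3 := h1 (n + N) (by omega)
      have e : n + 1 + N = n + N + 1 := by ring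
      rw [e]
      push_cast at h3 ih ⊢
      linarith
  refine (summable_nat_add_iff N).1 (summable_of_sum_range_le (c := 2 * (N * t N))
    (fun n => (H.pos _).le) fun n => (h2 n).trans ?_)
  have := mul_nonneg (Nat.cast_nonneg (α := ℝ) (n + N)) (H.pos (n + N)).le
  linarith

end Ratio

theorem pairSeq_succ (α β : ℚ) (n : ℕ) :
    pairSeq α β (n + 1) = pairSeq α β n * ((α + n) / (β + n)) := by
  rw [pairSeq, pairSeq, rising_succ, rising_succ, div_mul_div_comm]

theorem ratio_F : Ratio (fun n => (seqF n : ℝ) * (1 / 64) ^ n)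
    (fun n => (n + 1 / 4) * (n + 3 / 4)) (fun n => (n + 1) ^ 2) := by
  refine ⟨by simp [seqF, pairSeq_zero], fun n => by positivity, fun n => by positivity, fun n => ?_⟩
  simp only [seqF, pairSeq_succ]
  push_cast
  field_simp
  ring

theorem ratio_H : Ratio (fun n => (seqH n : ℝ))
    (fun n => (n + 1 / 6) * (n + 1 / 2)) (fun n => (n + 2 / 3) * (n + 1)) := by
  refine ⟨by simp [seqH, pairSeq_zero], fun n => by positivity, fun n => by positivity, fun n => ?_⟩
  simp only [seqH, pairSeq_succ]
  push_cast
  field_simp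
  ring

theorem ratio_I : Ratio (fun n => (seqI n : ℝ))
    (fun n => (n + 1 / 5) ^ 3) (fun n => (n + 2 / 7) * (n + 1) ^ 2) := by
  refine ⟨by simp [seqI, pairSeq_zero], fun n => by positivity, fun n => by positivity, fun n => ?_⟩
  simp only [seqI, pairSeq_succ]
  push_cast
  field_simp
  ring

theorem tame_F : Tame (fun n => (seqF n : ℝ)) (1 / 64) where
  pos := by norm_num
  zero := by simp [seqF, pairSeq_zero]
  nonneg n := (pos_of_mul_pos_left (ratio_F.pos n) (by positivity)).le
  upper := ⟨1, ratio_F.upper fun n => by have := Nat.cast_nonneg (α := ℝ) n; nlinarith⟩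

theorem tame_H : Tame (fun n => (seqH n : ℝ)) 1 where
  pos := by norm_num
  zero := ratio_H.zero
  nonneg n := (ratio_H.pos n).le
  upper := ⟨1, fun n => by
    rw [one_pow, mul_one]
    exact ratio_H.upper (fun n => by have := Nat.cast_nonneg (α := ℝ) n; nlinarith) n⟩

theorem tame_I : Tame (fun n => (seqI n : ℝ)) 1 where
  pos := by norm_num
  zero := ratio_I.zero
  nonneg n := (ratio_I.pos n).le
  upper := ⟨1, fun n => by
    rw [one_pow, mul_one]
    refine ratio_I.upper (fun n => ?_) n
    have := Nat.cast_nonneg (α := ℝ) n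
    have h2 : (0 : ℝ) ≤ n ^ 2 := by positivity
    have h3 : (0 : ℝ) ≤ n ^ 3 := by positivity
    ring_nf
    linarith⟩

theorem lower_F (n : ℕ) (hn : 1 ≤ n) :
    (seqF 1 : ℝ) * (1 / 64) ^ 1 / (n : ℝ) ^ 2 ≤ (seqF n : ℝ) * (1 / 64) ^ n :=
  ratio_F.lower 2 (fun n => by
    have := Nat.cast_nonneg (α := ℝ) n
    have : (0 : ℝ) ≤ (n + 1) ^ 2 * (n + 3 / 16) := by positivity
    linarith) n hn

theorem lower_I (n : ℕ) (hn : 1 ≤ n) : (seqI 1 : ℝ) / (n : ℝ) ^ 2 ≤ (seqI n : ℝ) * 1 ^ n := by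
  rw [one_pow, mul_one]
  refine ratio_I.lower 2 (fun n => ?_) n hn
  have h1 := Nat.cast_nonneg (α := ℝ) n
  have h2 : (0 : ℝ) ≤ (n + 1) ^ 2 * (n ^ 2 * (11 / 35) + 3 / 25 * n + 1 / 125) := by positivity
  linarith

/-- The parameters satisfy `1/6 + 1/2 = 2/3`, so the coefficients decay exactly like `1/n`. -/
theorem not_summable_H : ¬ Summable fun n => (seqH n : ℝ) * 1 ^ n := by
  intro hs
  simp only [one_pow, mul_one] at hs
  have h1 := ratio_H.lower 1 fun n => by
    have := Nat.cast_nonneg (α := ℝ) n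
    nlinarith
  refine Real.not_summable_one_div_natCast (Summable.of_nonneg_of_le (fun k => by positivity)
    (fun n => ?_) (hs.mul_left (1 / (seqH 1 : ℝ))))
  have h3 := ratio_H.pos 1
  rcases Nat.eq_zero_or_pos n with rfl | hn
  · simpa [ratio_H.zero] using h3.le
  · have h2 := h1 n hn
    rw [pow_one] at h2
    rw [one_div_mul_eq_div, le_div_iff₀ h3, one_div_mul_eq_div]
    exact h2

/-- The decay exponent is `2 + 2/7 - 3/5 = 59/35`. It exceeds 1 by `24/35`, which leaves room for
the constant `1/2` in Raabe's test. -/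
theorem summable_I : Summable fun n => (seqI n : ℝ) := by
  refine ratio_I.summable_of_raabe (N := 10) fun n hn => ?_
  have h1 : (10 : ℝ) ≤ n := by exact_mod_cast hn
  -- Expanding around 10 reduces the inequality to nonnegativity of powers of `x`.
  have h2 : (n : ℝ) = 10 + (n - 10) := by ring
  generalize (n : ℝ) - 10 = x at h2
  have h3 : 0 ≤ x := by linarith
  have h4 : 0 ≤ x ^ 2 := by positivity
  have h5 : 0 ≤ x ^ 3 := by positivity
  have h6 : 0 ≤ x ^ 4 := by positivity
  rw [h2]
  linarith

end Bounds

/-! ### Growth of the Apéry numbers through Delannoy numbers. -/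

section Apery

open Polynomial in
theorem coeff_one_add_C_mul_X_pow (a : ℝ) (N k : ℕ) :
    ((1 + C a * X : ℝ[X]) ^ N).coeff k = N.choose k * a ^ k := by
  have h1 : (1 + C a * X : ℝ[X]) ^ N = ((1 + X) ^ N : ℝ[X]).comp (C a * X) := by simp
  rw [h1, comp_C_mul_X_coeff, coeff_one_add_X_pow]

/-- `∑ₖ C(n,k) C(n+k,k)`, the central Delannoy number. -/
def delannoy (n : ℕ) : ℕ := ∑ k ∈ Finset.range (n + 1), n.choose k * (n + k).choose k

open Polynomial in
-- The trinomial is `(1 + X) * (1 + 2 X)`; expanding `((1 + X) + X) ^ n` produces the sum over `k`.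
theorem delannoy_eq_coeff (n : ℕ) :
    (delannoy n : ℝ) = ((1 + C 3 * X + C 2 * X ^ 2 : ℝ[X]) ^ n).coeff n := by
  have h1 : (1 + C 3 * X + C 2 * X ^ 2 : ℝ[X]) = (1 + X) * ((1 + X) + X) := by
    have h3 : (C 3 : ℝ[X]) = 3 := rfl
    have h2 : (C 2 : ℝ[X]) = 2 := rfl
    rw [h3, h2]; ring
  rw [h1, mul_pow, add_pow (1 + X : ℝ[X]) X, Finset.mul_sum, finsetSum_coeff, delannoy]
  push_cast
  refine Finset.sum_congr rfl fun k hk => ?_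
  have hk' : k ≤ n := Nat.lt_succ_iff.1 (Finset.mem_range.1 hk)
  have h4 : (1 + X : ℝ[X]) ^ n * ((1 + X) ^ k * X ^ (n - k) * (n.choose k : ℝ[X])) =
      C (n.choose k : ℝ) * ((1 + X) ^ (n + k) * X ^ (n - k)) := by
    rw [map_natCast]; ring
  rw [h4, coeff_C_mul]
  rw [coeff_mul_X_pow', if_pos (Nat.sub_le _ _), Nat.sub_sub_self hk', coeff_one_add_X_pow]

/-- The normalized central binomial coefficient `C(2m,m) / 4ᵐ`. -/
noncomputable def wallis (m : ℕ) : ℝ := m.centralBinom / 4 ^ m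

open Polynomial in
-- Completing the square writes the trinomial as `(1 + √2 X) ^ 2 + (3 - 2√2) X`. The result is a sum
-- of the `wallis m` against nonnegative binomial weights of total mass `(3 + 2√2) ^ n`, so both
-- bounds reduce to those for central binomial coefficients.
theorem delannoy_eq_sum (n : ℕ) : (delannoy n : ℝ) =
    ∑ m ∈ Finset.range (n + 1),
      (4 * √2) ^ m * (3 - 2 * √2) ^ (n - m) * n.choose m * wallis m := by
  have hs : √2 * √2 = 2 := Real.mul_self_sqrt (by norm_num)
  have h1 : (1 + C 3 * X + C 2 * X ^ 2 : ℝ[X]) =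
      (1 + C √2 * X) ^ 2 + C (3 - 2 * √2) * X := by
    have h2 : (C 2 : ℝ[X]) = C √2 * C √2 := by rw [← C_mul, hs]
    have h3 : (C (3 - 2 * √2) : ℝ[X]) = C 3 - 2 * C √2 := by
      rw [C_sub, C_mul]; rfl
    rw [h2, h3]; ring
  rw [delannoy_eq_coeff, h1, add_pow, finsetSum_coeff]
  refine Finset.sum_congr rfl fun m hm => ?_
  have hm' : m ≤ n := Nat.lt_succ_iff.1 (Finset.mem_range.1 hm)
  have h4 : ((1 + C √2 * X : ℝ[X]) ^ 2) ^ m * (C (3 - 2 * √2) * X) ^ (n - m) * (n.choose m : ℝ[X]) =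
      C ((3 - 2 * √2) ^ (n - m) * n.choose m) * ((1 + C √2 * X) ^ (2 * m) * X ^ (n - m)) := by
    rw [C_mul, C_pow, map_natCast, pow_mul]; ring
  rw [h4, coeff_C_mul]
  rw [coeff_mul_X_pow', if_pos (Nat.sub_le _ _), Nat.sub_sub_self hm',
    coeff_one_add_C_mul_X_pow, wallis, Nat.centralBinom_eq_two_mul_choose,
    mul_pow]
  field_simp

theorem wallis_pos (m : ℕ) : 0 < wallis m :=
  div_pos (by exact_mod_cast Nat.centralBinom_pos m) (by positivity)

theorem wallis_succ (m : ℕ) : wallis (m + 1) * (2 * m + 2) = wallis m * (2 * m + 1) := by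
  have h : ((m : ℝ) + 1) * (m + 1).centralBinom = 2 * (2 * m + 1) * m.centralBinom := by
    exact_mod_cast Nat.succ_mul_centralBinom_succ m
  rw [wallis, wallis, pow_succ]
  field_simp
  linear_combination 2 * h

theorem wallis_antitone : Antitone wallis := antitone_nat_of_succ_le fun m => by
  have h := wallis_succ m
  have := wallis_pos m
  have h2 : wallis (m + 1) * (2 * m + 2) ≤ wallis m * (2 * m + 2) := by rw [h]; gcongr; norm_num
  exact le_of_mul_le_mul_right h2 (by positivity)

theorem wallis_sq_le (m : ℕ) : wallis m ^ 2 ≤ 1 / ((m : ℝ) + 1) := by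
  -- This stronger form is the one that propagates by induction.
  have key : wallis m ^ 2 * (2 * m + 1) ≤ 1 := by
    induction m with
    | zero => simp [wallis]
    | succ m ih =>
      have h := wallis_succ m
      refine le_trans ?_ ih
      refine le_of_mul_le_mul_right (a := ((2 : ℝ) * m + 2) ^ 2) ?_ (by positivity)
      have h2 : wallis (m + 1) ^ 2 * (2 * m + 2) ^ 2 = wallis m ^ 2 * (2 * m + 1) ^ 2 := by
        rw [← mul_pow, h, mul_pow]
      push_cast
      calc wallis (m + 1) ^ 2 * (2 * (m + 1) + 1) * (2 * m + 2) ^ 2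
          = wallis m ^ 2 * (2 * m + 1) * ((2 * m + 1) * (2 * m + 3)) := by
            linear_combination (2 * (m : ℝ) + 3) * h2
        _ ≤ wallis m ^ 2 * (2 * m + 1) * (2 * m + 2) ^ 2 := by
          gcongr
          nlinarith
  rw [le_div_iff₀ (by positivity)]
  refine le_trans ?_ key
  gcongr
  have := Nat.cast_nonneg (α := ℝ) m
  linarith

theorem le_wallis_sq (m : ℕ) (hm : 1 ≤ m) : 1 / (4 * (m : ℝ)) ≤ wallis m ^ 2 := by
  rw [div_le_iff₀ (by positivity)]
  induction m, hm using Nat.le_induction with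
  | base => norm_num [wallis, Nat.centralBinom]
  | succ m hm ih =>
    have h := wallis_succ m
    refine le_trans ih ?_
    refine le_of_mul_le_mul_right (a := ((2 : ℝ) * m + 2) ^ 2) ?_ (by positivity)
    have h2 : wallis (m + 1) ^ 2 * (2 * m + 2) ^ 2 = wallis m ^ 2 * (2 * m + 1) ^ 2 := by
      rw [← mul_pow, h, mul_pow]
    push_cast
    calc wallis m ^ 2 * (4 * m) * (2 * m + 2) ^ 2
        = wallis m ^ 2 * (4 * (m * (2 * m + 2) ^ 2)) := by ring
      _ ≤ wallis m ^ 2 * (4 * ((m + 1) * (2 * m + 1) ^ 2)) := by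
        gcongr ?_ * (4 * ?_)
        have := Nat.cast_nonneg (α := ℝ) m
        nlinarith
      _ = wallis (m + 1) ^ 2 * (4 * (m + 1)) * (2 * m + 2) ^ 2 := by
        linear_combination -(4 * ((m : ℝ) + 1)) * h2

theorem sqrt_two_bounds : 1.414 < √2 ∧ √2 < 1.415 := by
  constructor
  · exact Real.lt_sqrt_of_sq_lt (by norm_num)
  · exact (Real.sqrt_lt' (by norm_num)).2 (by norm_num)

theorem le_delannoy (n : ℕ) : wallis n * (3 + 2 * √2) ^ n ≤ delannoy n := by
  have h0 := sqrt_two_bounds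
  have hb : 0 ≤ 3 - 2 * √2 := by linarith
  rw [delannoy_eq_sum, show 3 + 2 * √2 = 4 * √2 + (3 - 2 * √2) by ring, add_pow, Finset.mul_sum]
  refine Finset.sum_le_sum fun m hm => ?_
  rw [mul_comm]
  gcongr
  exact wallis_antitone (Nat.lt_succ_iff.1 (Finset.mem_range.1 hm))

/-- Cauchy–Schwarz in the weights reduces to averaging `1 / (m + 1)`, and that factor is absorbed by
raising the binomial coefficient from `n` to `n + 1`. -/
theorem delannoy_sq_le (n : ℕ) :
    (delannoy n : ℝ) ^ 2 ≤ ((3 + 2 * √2) ^ 2) ^ n * (2 / ((n : ℝ) + 1)) := by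
  have h0 := sqrt_two_bounds
  have hb : 0 ≤ 3 - 2 * √2 := by linarith
  set L : ℕ → ℝ := fun m => (4 * √2) ^ m * (3 - 2 * √2) ^ (n - m) * n.choose m with hL
  have hL0 : ∀ m, 0 ≤ L m := fun m => by positivity
  have hsum : ∑ m ∈ Finset.range (n + 1), L m = (3 + 2 * √2) ^ n := by
    rw [show 3 + 2 * √2 = 4 * √2 + (3 - 2 * √2) by ring, add_pow]
  have h1 : (delannoy n : ℝ) ^ 2 ≤ (∑ m ∈ Finset.range (n + 1), L m) *
      ∑ m ∈ Finset.range (n + 1), L m * wallis m ^ 2 := by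
    rw [delannoy_eq_sum]
    exact Finset.sum_sq_le_sum_mul_sum_of_sq_le_mul _ (fun m _ => hL0 m)
      (fun m _ => mul_nonneg (hL0 m) (sq_nonneg _)) fun m _ => by simp only [hL]; exact le_of_eq (by ring)
  have h2 : ∑ m ∈ Finset.range (n + 1), L m * wallis m ^ 2 ≤
      ∑ m ∈ Finset.range (n + 1), L m * (1 / ((m : ℝ) + 1)) :=
    Finset.sum_le_sum fun m _ => mul_le_mul_of_nonneg_left (wallis_sq_le m) (hL0 m)
  have h3 : (4 * √2 * (n + 1)) * ∑ m ∈ Finset.range (n + 1), L m * (1 / ((m : ℝ) + 1)) ≤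
      (3 + 2 * √2) ^ (n + 1) := by
    rw [show 3 + 2 * √2 = 4 * √2 + (3 - 2 * √2) by ring, add_pow, Finset.mul_sum,
      Finset.sum_range_succ' _ (n + 1)]
    refine le_add_of_le_of_nonneg (Finset.sum_le_sum fun m _ => ?_) (by positivity)
    have h4 : ((n : ℝ) + 1) * n.choose m = (n + 1).choose (m + 1) * (m + 1) := by
      exact_mod_cast Nat.add_one_mul_choose_eq n m
    have h5 : n + 1 - (m + 1) = n - m := by omega
    rw [h5, hL]
    simp only
    refine le_of_eq ?_
    field_simp
    linear_combination (√2 * (4 * √2) ^ m * 4 * (3 - 2 * √2) ^ (n - m)) * h4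
  have h6 : ∑ m ∈ Finset.range (n + 1), L m * (1 / ((m : ℝ) + 1)) ≤
      (3 + 2 * √2) ^ n * (2 / ((n : ℝ) + 1)) := by
    rw [← mul_div_assoc, le_div_iff₀ (by positivity)]
    refine le_of_mul_le_mul_left ?_ (show 0 < 4 * √2 by linarith)
    calc 4 * √2 * ((∑ m ∈ Finset.range (n + 1), L m * (1 / ((m : ℝ) + 1))) * (n + 1))
        ≤ (3 + 2 * √2) ^ (n + 1) := by linarith
      _ = (3 + 2 * √2) ^ n * (3 + 2 * √2) := pow_succ _ _
      _ ≤ (3 + 2 * √2) ^ n * (4 * √2 * 2) := by gcongr; linarith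
      _ = _ := by ring
  calc (delannoy n : ℝ) ^ 2 ≤ (3 + 2 * √2) ^ n * ((3 + 2 * √2) ^ n * (2 / ((n : ℝ) + 1))) := by
        refine h1.trans ?_
        rw [hsum]
        gcongr
        exact h2.trans h6
    _ = _ := by rw [sq, mul_pow, mul_assoc]

theorem apery_le (n : ℕ) : apery n ≤ delannoy n ^ 2 := by
  rw [apery, delannoy]
  simp only [← mul_pow]
  exact Finset.sum_sq_le_sq_sum_of_nonneg fun _ _ => Nat.zero_le _

theorem delannoy_sq_le_apery (n : ℕ) : delannoy n ^ 2 ≤ (n + 1) * apery n := by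
  rw [apery, delannoy]
  simp only [← mul_pow]
  simpa using sq_sum_le_card_mul_sum_sq (s := Finset.range (n + 1))
    (f := fun k => n.choose k * (n + k).choose k)

theorem rho_pow (n : ℕ) : ((3 + 2 * √2) ^ 2) ^ n * (17 - 12 * √2) ^ n = 1 := by
  have hs : √2 ^ 2 = 2 := Real.sq_sqrt (by norm_num)
  rw [← mul_pow, show (3 + 2 * √2) ^ 2 * (17 - 12 * √2) = 1 by
    linear_combination (-76 - 48 * √2) * hs, one_pow]

theorem tame_G : Tame (fun n => (seqG n : ℝ)) (17 - 12 * √2) where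
  pos := by linarith [sqrt_two_bounds.2]
  zero := by simp [seqG, apery]
  nonneg n := by simp [seqG]
  upper := ⟨2, fun n => by
    have h0 : 0 < 17 - 12 * √2 := by linarith [sqrt_two_bounds.2]
    have h1 : (apery n : ℝ) ≤ delannoy n ^ 2 := by exact_mod_cast apery_le n
    have h2 := delannoy_sq_le n
    have h3 := rho_pow n
    calc ((seqG n : ℚ) : ℝ) * (17 - 12 * √2) ^ n = apery n * (17 - 12 * √2) ^ n := by simp [seqG]
      _ ≤ ((3 + 2 * √2) ^ 2) ^ n * (2 / ((n : ℝ) + 1)) * (17 - 12 * √2) ^ n := by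
        gcongr; exact h1.trans h2
      _ = 2 / ((n : ℝ) + 1) := by linear_combination (2 / ((n : ℝ) + 1)) * h3⟩

/-- `1/8` combines `wallis n ^ 2 ≥ 1 / (4 n)` with the loss of `n + 1 ≤ 2 n` in Cauchy–Schwarz. -/
theorem lower_G (n : ℕ) (hn : 1 ≤ n) :
    (1 / 8 : ℝ) / (n : ℝ) ^ 2 ≤ (seqG n : ℝ) * (17 - 12 * √2) ^ n := by
  have h0 : 0 < 17 - 12 * √2 := by linarith [sqrt_two_bounds.2]
  have h1 : (delannoy n : ℝ) ^ 2 ≤ (n + 1) * apery n := by exact_mod_cast delannoy_sq_le_apery n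
  have h2 := le_delannoy n
  have h3 := rho_pow n
  have h4 := le_wallis_sq n hn
  have hn' : (1 : ℝ) ≤ n := by exact_mod_cast hn
  have hw := wallis_pos n
  have h5 : wallis n ^ 2 * ((3 + 2 * √2) ^ 2) ^ n ≤ (n + 1) * apery n := by
    refine le_trans ?_ h1
    rw [← pow_mul, mul_comm 2 n, pow_mul, ← mul_pow]
    exact pow_le_pow_left₀ (by positivity) h2 2
  have h6 : wallis n ^ 2 ≤ (n + 1) * (apery n * (17 - 12 * √2) ^ n) := by
    calc wallis n ^ 2 = wallis n ^ 2 * ((3 + 2 * √2) ^ 2) ^ n * (17 - 12 * √2) ^ n := by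
          rw [mul_assoc, h3, mul_one]
      _ ≤ (n + 1) * apery n * (17 - 12 * √2) ^ n := by gcongr
      _ = _ := by ring
  have h7 : ((seqG n : ℚ) : ℝ) = apery n := by simp [seqG]
  rw [h7]
  have h8 := h4.trans h6
  rw [div_le_iff₀ (by positivity)] at h8 ⊢
  have h9 : 0 ≤ (apery n : ℝ) * (17 - 12 * √2) ^ n := by positivity
  nlinarith [mul_le_mul_of_nonneg_left hn' (mul_nonneg h9 (zero_le_one.trans hn'))]

end Apery

/-! ### Multiplicative independence by comparing singularities. -/

theorem Tame.hasEval_pow {c : ℕ → ℝ} {ρ x : ℝ} (H : Tame c ρ) (hx0 : 0 ≤ x) (hx : x < ρ) (n : ℕ) :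
    HasEval (PowerSeries.mk c ^ n) x ((∑' k, c k * x ^ k) ^ n) :=
  (hasEval_mk (H.summable_norm hx0 hx)).pow n

theorem Tame.sum_pos {c : ℕ → ℝ} {ρ x : ℝ} (H : Tame c ρ) (hx0 : 0 ≤ x) (hx : x < ρ) :
    0 < ∑' k, c k * x ^ k :=
  one_pos.trans_le (H.one_le hx0 hx)

theorem Tame.contDiffAt {c : ℕ → ℝ} {ρ x : ℝ} (H : Tame c ρ) (hx0 : 0 ≤ x) (hx : x < ρ) :
    ContDiffAt ℝ 1 (fun x => ∑' n, c n * x ^ n) x :=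
  contDiffAt_tsum (r := (x + ρ) / 2) (by linarith)
    (H.summable_norm (by linarith) (by linarith)) (by rw [abs_of_nonneg hx0]; linarith)

/-- No positive power of the sum of `c` is, on `[0, ρ)`, a rational function divided by `G`. -/
def NoRational (c : ℕ → ℝ) (ρ : ℝ) (G : ℝ → ℝ) : Prop :=
  ∀ (n : ℕ) (P Q : Polynomial ℝ), n ≠ 0 → P ≠ 0 → Q ≠ 0 →
    (∀ x, 0 ≤ x → x < ρ → Q.eval x * ((∑' k, c k * x ^ k) ^ n * G x) = P.eval x) → False

/-- Comparison of exponents in a multiplicative relation. -/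
theorem exponent_eq {c : ℕ → ℝ} {ρ : ℝ} (H : Tame c ρ) {W W' : PowerSeries ℝ} {G G' : ℝ → ℝ}
    (hW : ∀ x, 0 ≤ x → x < ρ → HasEval W x (G x) ∧ 0 < G x)
    (hW' : ∀ x, 0 ≤ x → x < ρ → HasEval W' x (G' x) ∧ 0 < G' x)
    (h1 : NoRational c ρ fun x => G x / G' x) (h2 : NoRational c ρ fun x => G' x / G x)
    {P Q : Polynomial ℝ} (hP : P ≠ 0) (hQ : Q ≠ 0) {a b : ℕ}
    (h : (Q : PowerSeries ℝ) * (PowerSeries.mk c ^ a * W) =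
      (P : PowerSeries ℝ) * (PowerSeries.mk c ^ b * W')) : a = b := by
  have hev : ∀ x, 0 ≤ x → x < ρ → Q.eval x * ((∑' k, c k * x ^ k) ^ a * G x) =
      P.eval x * ((∑' k, c k * x ^ k) ^ b * G' x) := fun x hx0 hx => by
    have e1 := (HasEval.coe Q x).mul ((H.hasEval_pow hx0 hx a).mul (hW x hx0 hx).1)
    have e2 := (HasEval.coe P x).mul ((H.hasEval_pow hx0 hx b).mul (hW' x hx0 hx).1)
    rw [h] at e1
    exact e1.eq e2
  rcases lt_trichotomy a b with hab | hab | hab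
  · obtain ⟨n, rfl⟩ := Nat.exists_eq_add_of_le hab.le
    refine (h2 n Q P (by omega) hQ hP fun x hx0 hx => ?_).elim
    have e := hev x hx0 hx
    have hF := (H.sum_pos hx0 hx).ne'
    have hG := (hW x hx0 hx).2.ne'
    rw [pow_add] at e
    rw [mul_div_assoc', mul_div_assoc', div_eq_iff hG]
    exact mul_left_cancel₀ (pow_ne_zero a hF) (by linear_combination -e)
  · exact hab
  · obtain ⟨n, rfl⟩ := Nat.exists_eq_add_of_le hab.le
    refine (h1 n P Q (by omega) hP hQ fun x hx0 hx => ?_).elim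
    have e := hev x hx0 hx
    have hF := (H.sum_pos hx0 hx).ne'
    have hG := (hW' x hx0 hx).2.ne'
    rw [pow_add] at e
    rw [mul_div_assoc', mul_div_assoc', div_eq_iff hG]
    exact mul_left_cancel₀ (pow_ne_zero b hF) (by linear_combination e)

/-- The version of `exponent_eq` for cofactors smooth at the singularity. -/
theorem exponent_eq_of_contDiffAt {c : ℕ → ℝ} {ρ : ℝ} (H : Tame c ρ) {δ : ℝ} (hδ : 0 < δ)
    (hlo : ∀ n : ℕ, 1 ≤ n → δ / n ^ 2 ≤ c n * ρ ^ n) {W W' : PowerSeries ℝ} {G G' : ℝ → ℝ}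
    (hW : ∀ x, 0 ≤ x → x ≤ ρ → HasEval W x (G x) ∧ 0 < G x)
    (hW' : ∀ x, 0 ≤ x → x ≤ ρ → HasEval W' x (G' x) ∧ 0 < G' x)
    (hG : ContDiffAt ℝ 1 G ρ) (hG' : ContDiffAt ℝ 1 G' ρ)
    {P Q : Polynomial ℝ} (hP : P ≠ 0) (hQ : Q ≠ 0) {a b : ℕ}
    (h : (Q : PowerSeries ℝ) * (PowerSeries.mk c ^ a * W) =
      (P : PowerSeries ℝ) * (PowerSeries.mk c ^ b * W')) : a = b := by
  have h1 := (hW ρ H.pos.le le_rfl).2.ne'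
  have h2 := (hW' ρ H.pos.le le_rfl).2.ne'
  exact exponent_eq H (fun x hx0 hx => hW x hx0 hx.le) (fun x hx0 hx => hW' x hx0 hx.le)
    (fun n P Q hn hP hQ => H.false_of_contDiffAt hδ hlo hn (hG.div hG' h2) (div_ne_zero h1 h2) hP hQ)
    (fun n P Q hn hP hQ => H.false_of_contDiffAt hδ hlo hn (hG'.div hG h1) (div_ne_zero h2 h1) hP hQ)
    hP hQ h

/-- The cofactor is also singular at `1`, so smoothness is unavailable. Summability keeps it between
positive constants, and that suffices because the sum of `seqH` tends to infinity there. -/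
theorem noRational_H (a b : ℕ) : NoRational (fun n => (seqH n : ℝ)) 1 fun x =>
    (∑' k, (seqI k : ℝ) * x ^ k) ^ a / (∑' k, (seqI k : ℝ) * x ^ k) ^ b := by
  intro n P Q hn hP hQ h
  set M := ∑' k, (seqI k : ℝ)
  have hI : ∀ x : ℝ, 0 ≤ x → x < 1 →
      1 ≤ ∑' k, (seqI k : ℝ) * x ^ k ∧ ∑' k, (seqI k : ℝ) * x ^ k ≤ M := fun x hx0 hx =>
    ⟨tame_I.one_le hx0 hx, (tame_I.summable hx0 hx).tsum_le_tsum
      (fun k => mul_le_of_le_one_right (tame_I.nonneg k) (pow_le_one₀ hx0 hx.le)) summable_I⟩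
  have hM : 1 ≤ M := (hI 0 le_rfl one_pos).1.trans (hI 0 le_rfl one_pos).2
  refine false_of_tendsto_atTop hn (tame_H.tendsto_atTop not_summable_H) (tame_H.tendsto_mul_pow n)
    (m := 1 / M ^ b) (M := M ^ a) (by positivity) ?_ hP hQ ?_
    (G := fun x => (∑' k, (seqI k : ℝ) * x ^ k) ^ a / (∑' k, (seqI k : ℝ) * x ^ k) ^ b)
  · filter_upwards [tame_H.eventually_left] with x hx
    obtain ⟨h1, h2⟩ := hI x hx.1.le hx.2
    generalize ∑' k, (seqI k : ℝ) * x ^ k = y at h1 h2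
    rw [abs_of_pos (by positivity)]
    constructor
    · gcongr
      exact one_le_pow₀ h1
    · refine (div_le_self (by positivity) (one_le_pow₀ h1)).trans ?_
      gcongr
  · filter_upwards [tame_H.eventually_left] with x hx using h x hx.1.le hx.2

/-- The four series are multiplicatively independent modulo rational functions. -/
theorem exponents_eq {P Q : Polynomial ℝ} (hP : P ≠ 0) (hQ : Q ≠ 0) {a b : Fin 4 → ℕ}
    (h : (Q : PowerSeries ℝ) * (PowerSeries.mk (fun n => (seqF n : ℝ)) ^ a 0 *
        (PowerSeries.mk (fun n => (seqG n : ℝ)) ^ a 1 *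
          (PowerSeries.mk (fun n => (seqH n : ℝ)) ^ a 2 *
            PowerSeries.mk (fun n => (seqI n : ℝ)) ^ a 3))) =
      (P : PowerSeries ℝ) * (PowerSeries.mk (fun n => (seqF n : ℝ)) ^ b 0 *
        (PowerSeries.mk (fun n => (seqG n : ℝ)) ^ b 1 *
          (PowerSeries.mk (fun n => (seqH n : ℝ)) ^ b 2 *
            PowerSeries.mk (fun n => (seqI n : ℝ)) ^ b 3)))) : a = b := by
  have hs := sqrt_two_bounds
  have cancel : ∀ {c : ℕ → ℝ} {ρ : ℝ} (_ : Tame c ρ) {W W' : PowerSeries ℝ} {n : ℕ},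
      (Q : PowerSeries ℝ) * (PowerSeries.mk c ^ n * W) =
        (P : PowerSeries ℝ) * (PowerSeries.mk c ^ n * W') →
      (Q : PowerSeries ℝ) * W = (P : PowerSeries ℝ) * W' := by
    intro c ρ H W W' n hn
    have h0 : PowerSeries.mk c ≠ 0 := fun h0 => by
      have := congrArg (PowerSeries.coeff 0) h0
      simp [H.zero] at this
    exact mul_left_cancel₀ (pow_ne_zero n h0) (by linear_combination hn)
  have HI : ∀ x, 0 ≤ x → x < 1 → ∀ n, HasEval (PowerSeries.mk (fun n => (seqI n : ℝ)) ^ n) x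
      ((∑' k, (seqI k : ℝ) * x ^ k) ^ n) ∧ 0 < (∑' k, (seqI k : ℝ) * x ^ k) ^ n :=
    fun x hx0 hx n => ⟨tame_I.hasEval_pow hx0 hx n, pow_pos (tame_I.sum_pos hx0 hx) n⟩
  have HH : ∀ x, 0 ≤ x → x < 1 → ∀ n, HasEval (PowerSeries.mk (fun n => (seqH n : ℝ)) ^ n) x
      ((∑' k, (seqH k : ℝ) * x ^ k) ^ n) ∧ 0 < (∑' k, (seqH k : ℝ) * x ^ k) ^ n :=
    fun x hx0 hx n => ⟨tame_H.hasEval_pow hx0 hx n, pow_pos (tame_H.sum_pos hx0 hx) n⟩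
  have HG : ∀ x, 0 ≤ x → x < 17 - 12 * √2 → ∀ n,
      HasEval (PowerSeries.mk (fun n => (seqG n : ℝ)) ^ n) x
      ((∑' k, (seqG k : ℝ) * x ^ k) ^ n) ∧ 0 < (∑' k, (seqG k : ℝ) * x ^ k) ^ n :=
    fun x hx0 hx n => ⟨tame_G.hasEval_pow hx0 hx n, pow_pos (tame_G.sum_pos hx0 hx) n⟩
  -- The singularities are treated in increasing order: at each of `1/64` and `17 - 12√2` the series
  -- still present have larger radii and are smooth there.
  have e0 : a 0 = b 0 := by
    have key : ∀ d : Fin 4 → ℕ, ∀ x, 0 ≤ x → x ≤ (1 / 64 : ℝ) →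
        HasEval (PowerSeries.mk (fun n => (seqG n : ℝ)) ^ d 1 *
          (PowerSeries.mk (fun n => (seqH n : ℝ)) ^ d 2 *
            PowerSeries.mk (fun n => (seqI n : ℝ)) ^ d 3)) x
          ((∑' k, (seqG k : ℝ) * x ^ k) ^ d 1 * ((∑' k, (seqH k : ℝ) * x ^ k) ^ d 2 *
            (∑' k, (seqI k : ℝ) * x ^ k) ^ d 3)) ∧
          0 < (∑' k, (seqG k : ℝ) * x ^ k) ^ d 1 * ((∑' k, (seqH k : ℝ) * x ^ k) ^ d 2 *
            (∑' k, (seqI k : ℝ) * x ^ k) ^ d 3) := fun d x hx0 hx => by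
      obtain ⟨g1, g2⟩ := HG x hx0 (by linarith) (d 1)
      obtain ⟨h1, h2⟩ := HH x hx0 (by linarith) (d 2)
      obtain ⟨i1, i2⟩ := HI x hx0 (by linarith) (d 3)
      exact ⟨g1.mul (h1.mul i1), mul_pos g2 (mul_pos h2 i2)⟩
    have smooth : ∀ d : Fin 4 → ℕ, ContDiffAt ℝ 1 (fun x : ℝ => (∑' k, (seqG k : ℝ) * x ^ k) ^ d 1 *
        ((∑' k, (seqH k : ℝ) * x ^ k) ^ d 2 * (∑' k, (seqI k : ℝ) * x ^ k) ^ d 3)) (1 / 64) :=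
      fun d => ((tame_G.contDiffAt (by norm_num) (by linarith)).pow _).mul
        (((tame_H.contDiffAt (by norm_num) (by norm_num)).pow _).mul
          ((tame_I.contDiffAt (by norm_num) (by norm_num)).pow _))
    exact exponent_eq_of_contDiffAt tame_F (ratio_F.pos 1) lower_F (key a) (key b) (smooth a)
      (smooth b) hP hQ h
  rw [e0] at h
  replace h := cancel tame_F h
  have e1 : a 1 = b 1 := by
    have key : ∀ d : Fin 4 → ℕ, ∀ x, 0 ≤ x → x ≤ 17 - 12 * √2 →
        HasEval (PowerSeries.mk (fun n => (seqH n : ℝ)) ^ d 2 *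
            PowerSeries.mk (fun n => (seqI n : ℝ)) ^ d 3) x
          ((∑' k, (seqH k : ℝ) * x ^ k) ^ d 2 * (∑' k, (seqI k : ℝ) * x ^ k) ^ d 3) ∧
          0 < (∑' k, (seqH k : ℝ) * x ^ k) ^ d 2 * (∑' k, (seqI k : ℝ) * x ^ k) ^ d 3 :=
      fun d x hx0 hx => by
        obtain ⟨h1, h2⟩ := HH x hx0 (by linarith) (d 2)
        obtain ⟨i1, i2⟩ := HI x hx0 (by linarith) (d 3)
        exact ⟨h1.mul i1, mul_pos h2 i2⟩
    have smooth : ∀ d : Fin 4 → ℕ, ContDiffAt ℝ 1 (fun x : ℝ =>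
        (∑' k, (seqH k : ℝ) * x ^ k) ^ d 2 * (∑' k, (seqI k : ℝ) * x ^ k) ^ d 3)
          (17 - 12 * √2) :=
      fun d => ((tame_H.contDiffAt (by linarith) (by linarith)).pow _).mul
          ((tame_I.contDiffAt (by linarith) (by linarith)).pow _)
    exact exponent_eq_of_contDiffAt tame_G (by norm_num) lower_G (key a) (key b) (smooth a)
      (smooth b) hP hQ h
  rw [e1] at h
  replace h := cancel tame_G h
  have e2 : a 2 = b 2 := exponent_eq tame_H (fun x hx0 hx => HI x hx0 hx (a 3))
    (fun x hx0 hx => HI x hx0 hx (b 3)) (noRational_H _ _) (noRational_H _ _) hP hQ h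
  rw [e2] at h
  replace h := cancel tame_H h
  have e3 : a 3 = b 3 := by
    have hone : ∀ x : ℝ, HasEval (1 : PowerSeries ℝ) x 1 := fun x => by
      simpa using HasEval.coe 1 x
    exact exponent_eq_of_contDiffAt tame_I (ratio_I.pos 1) lower_I
      (W := 1) (W' := 1) (G := fun _ => 1) (G' := fun _ => 1)
      (fun x _ _ => ⟨hone x, one_pos⟩) (fun x _ _ => ⟨hone x, one_pos⟩) contDiffAt_const
      contDiffAt_const hP hQ (by rw [mul_one, mul_one]; exact h)
  ext j
  fin_cases j
  exacts [e0, e1, e2, e3]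

/-- The coefficient sequences, indexed. -/
def coeffSeq : Fin 4 → ℕ → ℚ := ![seqF, seqG, seqH, seqI]

theorem isLucas_coeffSeq (N : ℕ) : ∃ p : ℕ, ∃ _ : Fact p.Prime, N < p ∧
    ∀ j, IsLucas p (coeffSeq j) := by
  -- 420 is the least common multiple of the denominators 2, 3, 4, 5, 6, 7 of the parameters.
  obtain ⟨p, hp, hN, hmod⟩ := Nat.exists_prime_gt_modEq_one (k := 420) N (by norm_num)
  have : Fact p.Prime := ⟨hp⟩
  have hp' : p = 420 * (p / 420) + 1 := by
    have h1 : p % 420 = 1 := hmod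
    omega
  obtain ⟨h0, h1, h2, h3⟩ := isLucas_seq hp'
  refine ⟨p, this, hN, fun j => ?_⟩
  fin_cases j
  exacts [h0, h1, h2, h3]

theorem coeffSeq_zero (j : Fin 4) : coeffSeq j 0 = 1 := by
  fin_cases j
  · simp [coeffSeq, seqF, pairSeq_zero]
  · simp [coeffSeq, seqG, apery]
  · simp [coeffSeq, seqH, pairSeq_zero]
  · simp [coeffSeq, seqI, pairSeq_zero]

end LucasSeries

theorem theorem9p6 :
    AlgebraicIndependent (RatFunc ℂ)
      (![(MixedExample.f : LaurentSeries ℂ), (MixedExample.g : LaurentSeries ℂ),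
        (MixedExample.h : LaurentSeries ℂ), (MixedExample.i : LaurentSeries ℂ)] :
        Fin 4 → LaurentSeries ℂ) := by
  have e : (![(MixedExample.f : LaurentSeries ℂ), (MixedExample.g : LaurentSeries ℂ),
      (MixedExample.h : LaurentSeries ℂ), (MixedExample.i : LaurentSeries ℂ)] :
      Fin 4 → LaurentSeries ℂ) = fun j => (PowerSeries.map (algebraMap ℚ ℂ)
        (PowerSeries.mk (LucasSeries.coeffSeq j)) : LaurentSeries ℂ) := by
    rw [LucasSeries.f_eq, LucasSeries.g_eq, LucasSeries.h_eq, LucasSeries.i_eq]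
    ext1 j
    fin_cases j <;> rfl
  rw [e]
  by_contra hdep
  obtain ⟨m, m', hne, P, Q, hP, hQ, hPQ⟩ := LucasSeries.exists_multiplicative_relation
    LucasSeries.coeffSeq_zero LucasSeries.isLucas_coeffSeq hdep
  refine hne (LucasSeries.exponents_eq (P := P.map (algebraMap ℚ ℝ)) (Q := Q.map (algebraMap ℚ ℝ))
    ?_ ?_ ?_)
  · simpa using hP
  · simpa using hQ
  · have hmk : ∀ a : ℕ → ℚ, PowerSeries.map (algebraMap ℚ ℝ) (PowerSeries.mk a) =
        PowerSeries.mk fun n => (a n : ℝ) := fun a => by ext n; simp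
    have hpol : ∀ R : Polynomial ℚ, PowerSeries.map (algebraMap ℚ ℝ) (R : PowerSeries ℚ) =
        (R.map (algebraMap ℚ ℝ) : Polynomial ℝ) := fun R => by ext n; simp
    have h1 := congrArg (PowerSeries.map (algebraMap ℚ ℝ)) hPQ
    rw [map_mul, map_mul, LucasSeries.map_monom, LucasSeries.map_monom, hpol, hpol] at h1
    simp only [hmk, LucasSeries.monom, Fin.prod_univ_four, mul_assoc] at h1
    exact h1
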